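/- Let $1\le p,q<\infty$ with $p\ne q$, and let $L_p(L_q)=L_p([0,1];L_q[0,1])$ be the Banach lattice of (classes of) Bochner measurable $f:[0,1]\to L_q[0,1]$ with $\|f\|=\big(\int_0^1\|f(x)\|_q^p\,dx\big)^{1/p}<\infty$, with pointwise almost everywhere order. A Banach lattice $X$ is an (abstract) $L_pL_q$ lattice if there are a measure space $(\Omega,\Sigma,\mu)$, an $L_\infty(\Omega)$-module structure on $X$ and a map $N:X\to L_p(\Omega)_+$ such that $\phi\cdot x\ge 0$ for $0\le\phi\in L_\infty(\Omega)$ and $0\le x\in X$; $N[\phi\cdot x]=|\phi|N[x]$; $N[x+y]\le N[x]+N[y]$; $N[x+y]^q=N[x]^q+N[y]^q$ if $x,y$ are disjoint; $N[x]\le N[y]$ if $|x|\le|y|$; and $\|x\|=\|N[x]\|_{L_p}$. A $BL_pL_q$ lattice is a Banach lattice that is isometrically lattice isomorphic to a band of an $L_pL_q$ lattice. (The finite-dimensional ones are the lattices $\big(\ell_q^{m_1}\oplus\dots\oplus\ell_q^{m_n}\big)_{\ell_p}$, with atoms $e(k,j)$, $1\le k\le n$, $1\le j\le m_k$.) **Theorem.**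 Let $E$ be a finite-dimensional $BL_pL_q$ lattice, and let $f_1,f_2:E\to L_p(L_q)$ be isometric lattice embeddings (linear isometries preserving $\vee$ and $\wedge$) such that each $f_i(E)$ fully supports $L_p(L_q)$, that is, the only element of $L_p(L_q)$ disjoint from every element of $f_i(E)$ is $0$. Then there is an isometric lattice automorphism $\phi$ of $L_p(L_q)$ (a surjective linear isometry preserving $\vee$ and $\wedge$) with $\phi\circ f_1=f_2$. -/

import Mathlib

open MeasureTheory
open scoped ENNReal unitInterval

universe u v w

/-- The Banach lattice `L_p(L_q) = L_p([0,1]; L_q[0,1])` of (classes of) Bochner measurable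
functions `f : [0,1] → L_q[0,1]` whose fibre norm `x ↦ ‖f x‖_q` is in `L_p[0,1]`, with Lebesgue
measure on both copies of `[0,1]`, with norm `‖f‖ = (∫ ‖f x‖_q ^ p dx) ^ (1/p)` and with the
(almost everywhere) pointwise linear and lattice operations. -/
abbrev LpLq (p q : ℝ≥0∞) [Fact (1 ≤ q)] : Type :=
  Lp (Lp ℝ q (volume : Measure I)) p (volume : Measure I)

/-- `f` is a lattice homomorphism (for maps that are already known to be linear). -/
structure PreservesLattice {X : Type*} {Y : Type*} [Lattice X] [Lattice Y] (f : X → Y) :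
    Prop where
  map_sup : ∀ x y : X, f (x ⊔ y) = f x ⊔ f y
  map_inf : ∀ x y : X, f (x ⊓ y) = f x ⊓ f y

/-- The lattice-theoretic disjointness `x ⊥ y`. -/
def LatticeDisjoint {X : Type*} [Lattice X] [AddCommGroup X] (x y : X) : Prop :=
  |x| ⊓ |y| = 0

/-- A band of a vector lattice: a solid linear subspace that contains the supremum of each of its
subsets that has a supremum in the whole lattice. -/
structure IsBand {X : Type*} [NormedAddCommGroup X] [NormedSpace ℝ X] [Lattice X]
    (B : Submodule ℝ X) : Prop where
  solid : LatticeOrderedAddCommGroup.IsSolid (B : Set X)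
  sup_mem : ∀ S : Set X, S ⊆ (B : Set X) → ∀ x : X, IsLUB S x → x ∈ B

/-- The set `S` fully supports the lattice `X`: no nonzero element of `X` is disjoint from all
elements of `S`. In a function lattice: the union of the supports of the elements of `S` is
everything, up to null sets. -/
def FullySupports {X : Type*} [Lattice X] [AddCommGroup X] (S : Set X) : Prop :=
  ∀ x : X, (∀ s ∈ S, LatticeDisjoint x s) → x = 0

/-- The structure of an abstract `L_pL_q` lattice over the measure space `(Ω, μ)` on a Banach
lattice `X`: a module structure `act` over the algebra `L_∞(Ω)` and a random norm
`N : X → L_p(Ω)₊`. -/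
structure AbstractLpLq (p q : ℝ≥0∞) {Ω : Type w} [MeasurableSpace Ω] (μ : Measure Ω)
    (X : Type v) [NormedAddCommGroup X] [NormedSpace ℝ X] [Lattice X] where
  /-- The action of `L_∞(Ω)` on `X`, bilinear over `ℝ`. -/
  act : Lp ℝ ∞ μ →ₗ[ℝ] X →ₗ[ℝ] X
  /-- The random norm. -/
  N : X → Lp ℝ p μ
  act_one : ∀ φ : Lp ℝ ∞ μ, (∀ᵐ ω ∂μ, φ ω = 1) → ∀ x : X, act φ x = x
  act_mul : ∀ φ ψ χ : Lp ℝ ∞ μ, (∀ᵐ ω ∂μ, χ ω = φ ω * ψ ω) →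
    ∀ x : X, act χ x = act φ (act ψ x)
  act_nonneg : ∀ φ : Lp ℝ ∞ μ, 0 ≤ φ → ∀ x : X, 0 ≤ x → 0 ≤ act φ x
  N_nonneg : ∀ x : X, 0 ≤ N x
  N_act : ∀ (φ : Lp ℝ ∞ μ) (x : X), ∀ᵐ ω ∂μ, N (act φ x) ω = |φ ω| * N x ω
  N_add_le : ∀ x y : X, N (x + y) ≤ N x + N y
  N_add_of_disjoint : ∀ x y : X, LatticeDisjoint x y →
    ∀ᵐ ω ∂μ, (N (x + y) ω) ^ q.toReal = (N x ω) ^ q.toReal + (N y ω) ^ q.toReal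
  N_mono : ∀ x y : X, |x| ≤ |y| → N x ≤ N y
  norm_eq : ∀ x : X, ‖x‖ = ‖N x‖

/-- `E` is a `BL_pL_q` lattice: it is (isometrically lattice isomorphic to) a band of a Banach
lattice `X` that is an abstract `L_pL_q` lattice over some measure space. -/
def IsBLpLq (p q : ℝ≥0∞) (E : Type u) [NormedAddCommGroup E] [NormedSpace ℝ E] [Lattice E] :
    Prop :=
  ∃ (X : Type v) (_ : NormedAddCommGroup X) (_ : NormedSpace ℝ X) (_ : Lattice X)
    (_ : HasSolidNorm X) (_ : IsOrderedAddMonoid X) (_ : IsOrderedModule ℝ X)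
    (_ : CompleteSpace X) (Ω : Type w) (_ : MeasurableSpace Ω) (μ : Measure Ω)
    (_ : AbstractLpLq p q μ X) (ι : E →ₗᵢ[ℝ] X),
    PreservesLattice ι ∧ IsBand (LinearMap.range ι.toLinearMap)

/-! A finite-dimensional `E` is spanned by disjoint normalized atoms (`exists_atoms`). In an
abstract $L_pL_q$ lattice, multiplication by an indicator function sends an atom to 0 or to itself,
so no measurable set can split the random norm of an atom. Hence two normalized atoms have random
norms that are equal or disjoint, and the norm of their sum is $2^{1/q}$ or $2^{1/p}$ respectively
(`IsBLpLq.norm_add_atoms`). Nothing else about the $BL_pL_q$ structure is needed.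

Under an embedding into $L_p(L_q)$, two disjoint positive images $f,g$ satisfy
$\|f+g\|^p=\int(\|f(x)\|^q+\|g(x)\|^q)^{p/q}dx$. Since $p/q\ne1$, the equality cases of the midpoint
inequality and of the additivity inequality for $t\mapsto t^{p/q}$ show that the first alternative
forces equal fibre norms and the second forces one of the two fibres to vanish, almost everywhere.
The atoms thus split into classes: one fibre norm per class, disjoint fibre norms for different
classes, and these cover $[0,1]$ by full support. The classes depend only on norms in `E`, so they
are the same for both embeddings.

The automorphism is built by two changes of variable. On the base, the distribution functions of the
$p$-th powers of the fibre norms map $[0,1]$ onto one copy of $[0,1]$ per class, and weighted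
composition turns the fibre norms into indicators (`AtomSystem.exists_normalization`). In almost
every fibre, the atoms of the class form a disjoint normalized tuple covering $[0,1]$, and the same
construction with exponent $q$ carries one such tuple to another. These fibre isometries must vary
measurably with the base point: as distribution functions are canonical, the isometry is continuous
in the tuple (`GoodTuple.iso_close`), and no measurable selection is required. -/

set_option linter.unusedSectionVars false

/-! ### Atoms of finite-dimensional normed vector lattices -/

section VectorLattice

variable {E : Type*} [NormedAddCommGroup E] [NormedSpace ℝ E] [Lattice E] [HasSolidNorm E]
  [IsOrderedAddMonoid E] [IsOrderedModule ℝ E]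

theorem add_inf_eq_zero_of_nonneg {x y d : E} (hx : 0 ≤ x) (hy : 0 ≤ y) (hd : 0 ≤ d)
    (hxd : x ⊓ d = 0) (hyd : y ⊓ d = 0) : (x + y) ⊓ d = 0 := by
  have h0 : 0 ≤ (x + y) ⊓ d := le_inf (add_nonneg hx hy) hd
  refine le_antisymm ?_ h0
  have h1 : (x + y) ⊓ d - y ≤ x ⊓ d :=
    le_inf (by rw [sub_le_iff_le_add]; exact inf_le_left)
      (by rw [sub_le_iff_le_add]; exact inf_le_right.trans (le_add_of_nonneg_right hy))
  rw [hxd, sub_nonpos] at h1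
  exact (le_inf h1 inf_le_right).trans hyd.le

theorem smul_inf_eq_zero_of_nonneg {x d : E} (hx : 0 ≤ x) (hd : 0 ≤ d) (h : x ⊓ d = 0) {c : ℝ}
    (hc : 0 ≤ c) : (c • x) ⊓ d = 0 := by
  refine le_antisymm ?_ (le_inf (smul_nonneg hc hx) hd)
  -- The factor `c + 1` is positive even for `c = 0` and dominates both `c` and 1, so dividing by it
  -- brings the meet below `x` and below `d`.
  have hc1 : 0 < c + 1 := by linarith
  have h1 : (c + 1)⁻¹ • ((c • x) ⊓ d) ≤ x ⊓ d := by
    refine le_inf ?_ ?_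
    · rw [inv_smul_le_iff_of_pos hc1]
      exact inf_le_left.trans (smul_le_smul_of_nonneg_right (by linarith) hx)
    · rw [inv_smul_le_iff_of_pos hc1]
      refine inf_le_right.trans ?_
      rw [add_smul, one_smul]
      exact le_add_of_nonneg_left (smul_nonneg hc hd)
  rw [h, inv_smul_le_iff_of_pos hc1, smul_zero] at h1
  exact h1

theorem inf_eq_zero_of_le {x y d : E} (hx : 0 ≤ x) (hd : 0 ≤ d) (h : x ≤ y) (hy : y ⊓ d = 0) :
    x ⊓ d = 0 :=
  le_antisymm ((inf_le_inf_right d h).trans hy.le) (le_inf hx hd)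

/-- The disjoint complement of a positive element. -/
def disjointComplement (d : E) (hd : 0 ≤ d) : Submodule ℝ E where
  carrier := {x | |x| ⊓ d = 0}
  zero_mem' := by simp [hd]
  add_mem' := by
    intro x y hx hy
    exact inf_eq_zero_of_le (abs_nonneg _) hd (abs_add_le x y)
      (add_inf_eq_zero_of_nonneg (abs_nonneg x) (abs_nonneg y) hd hx hy)
  smul_mem' := by
    intro c x hx
    refine inf_eq_zero_of_le (y := |c| • |x|) (abs_nonneg _) hd ?_
      (smul_inf_eq_zero_of_nonneg (abs_nonneg x) hd hx (abs_nonneg c))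
    have h : ∀ (a : ℝ) (z : E), a • z ≤ |a| • |z| := by
      intro a z
      rcases le_total 0 a with ha | ha
      · rw [abs_of_nonneg ha]
        exact smul_le_smul_of_nonneg_left (le_abs_self z) ha
      · rw [abs_of_nonpos ha, ← neg_smul_neg]
        exact smul_le_smul_of_nonneg_left (neg_le_abs z) (neg_nonneg.mpr ha)
    refine sup_le (h c x) ?_
    rw [← neg_smul, ← abs_neg c]
    exact h (-c) x

/-- The span of the other vectors lies in the disjoint complement of `e i`, whereas a vector
disjoint from itself is zero. -/
theorem linearIndependent_of_disjoint {ι : Type*} {e : ι → E} (he0 : ∀ i, 0 ≤ e i)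
    (hne : ∀ i, e i ≠ 0) (hd : Pairwise fun i j => e i ⊓ e j = 0) : LinearIndependent ℝ e := by
  rw [linearIndependent_iff_notMem_span]
  intro i hi
  have hle : Submodule.span ℝ (e '' (Set.univ \ {i})) ≤ disjointComplement (e i) (he0 i) := by
    rw [Submodule.span_le]
    rintro _ ⟨j, hj, rfl⟩
    change |e j| ⊓ e i = 0
    rw [abs_of_nonneg (he0 j)]
    exact hd (by simpa using hj)
  have := hle hi
  change |e i| ⊓ e i = 0 at this
  rw [abs_of_nonneg (he0 i), inf_idem] at this
  exact hne i this

/-- The order is closed, so the supremum of admissible `s` is attained; monotonicity of the norm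
bounds them by `‖x‖ / ‖e‖`. -/
theorem exists_max_smul_le {x e : E} (hx : 0 ≤ x) (he : 0 ≤ e) (hne : e ≠ 0) :
    ∃ t : ℝ, 0 ≤ t ∧ t • e ≤ x ∧ ∀ s : ℝ, s • e ≤ x → s ≤ t := by
  have hbd : ∀ s : ℝ, s • e ≤ x → s ≤ ‖x‖ / ‖e‖ := by
    intro s hs
    rw [le_div_iff₀ (norm_pos_iff.mpr hne)]
    rcases le_total s 0 with h | h
    · exact (mul_nonpos_of_nonpos_of_nonneg h (norm_nonneg _)).trans (norm_nonneg _)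
    · have : |s • e| ≤ |x| := by
        rwa [abs_of_nonneg (smul_nonneg h he), abs_of_nonneg hx]
      have := norm_le_norm_of_abs_le_abs this
      rwa [norm_smul, Real.norm_of_nonneg h] at this
  have hcl : IsClosed {s : ℝ | s • e ≤ x} :=
    isClosed_le (by fun_prop) continuous_const
  have hne' : {s : ℝ | s • e ≤ x}.Nonempty := ⟨0, by simpa using hx⟩
  have hb : BddAbove {s : ℝ | s • e ≤ x} := ⟨_, hbd⟩
  refine ⟨sSup {s : ℝ | s • e ≤ x}, le_csSup hb (by simpa using hx), hcl.csSup_mem hne' hb,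
    fun s hs => le_csSup hb hs⟩

/-- A finite set of nonzero positive pairwise disjoint vectors. -/
def IsDisjointPositive (s : Finset E) : Prop :=
  (∀ x ∈ s, 0 ≤ x ∧ x ≠ 0) ∧ ∀ x ∈ s, ∀ y ∈ s, x ≠ y → x ⊓ y = 0

theorem exists_maximal_isDisjointPositive (E : Type*) [NormedAddCommGroup E] [NormedSpace ℝ E]
    [Lattice E] [HasSolidNorm E] [IsOrderedAddMonoid E] [IsOrderedModule ℝ E]
    [FiniteDimensional ℝ E] :
    ∃ s : Finset E, IsDisjointPositive s ∧ ∀ t : Finset E, IsDisjointPositive t →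
      t.card ≤ s.card := by
  classical
  have hb : ∀ t : Finset E, IsDisjointPositive t → t.card ≤ Module.finrank ℝ E := by
    intro t ht
    have : LinearIndependent ℝ (fun x : t => (x : E)) :=
      linearIndependent_of_disjoint (fun i => (ht.1 i i.2).1) (fun i => (ht.1 i i.2).2)
        (fun i j hij => ht.2 i i.2 j j.2 (fun h => hij (Subtype.ext h)))
    simpa using this.fintype_card_le_finrank
  obtain ⟨n, ⟨s, hs, hsn⟩, hmax⟩ : ∃ n, (∃ t : Finset E, IsDisjointPositive t ∧ t.card = n) ∧
      ∀ m, (∃ t : Finset E, IsDisjointPositive t ∧ t.card = m) → m ≤ n := by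
    refine ⟨_, Nat.findGreatest_spec (P := fun n => ∃ t : Finset E, IsDisjointPositive t ∧
      t.card = n) (n := Module.finrank ℝ E) (Nat.zero_le _) ⟨∅, ⟨by simp, by simp⟩, rfl⟩, ?_⟩
    rintro m ⟨t, ht, rfl⟩
    exact Nat.le_findGreatest (hb t ht) ⟨t, ht, rfl⟩
  exact ⟨s, hs, fun t ht => hsn ▸ hmax _ ⟨t, ht, rfl⟩⟩

/-- Members of a disjoint family of maximal cardinality are atoms. Remove from `x` the largest
multiple of `e`. If the remainder `y` were not below some `ε • e`, the positive and negative parts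
of `y - ε • e` would be two nonzero disjoint vectors that could replace `e`, giving a larger family.
-/
theorem eq_smul_of_le_of_maximal {s : Finset E} (hs : IsDisjointPositive s)
    (hmax : ∀ t : Finset E, IsDisjointPositive t → t.card ≤ s.card) {e x : E} (he : e ∈ s)
    (hx : 0 ≤ x) (hxe : x ≤ e) : ∃ t : ℝ, x = t • e := by
  classical
  have he0 := (hs.1 e he).1
  obtain ⟨t, ht0, htx, htm⟩ := exists_max_smul_le hx he0 (hs.1 e he).2
  refine ⟨t, ?_⟩
  set y := x - t • e with hy
  have hy0 : 0 ≤ y := sub_nonneg.mpr htx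
  have hye : y ≤ e := (sub_le_self _ (smul_nonneg ht0 he0)).trans hxe
  have key : ∀ ε : ℝ, 0 < ε → y ≤ ε • e := by
    intro ε hε
    by_contra hcon
    have hu : (y - ε • e)⁺ ≠ 0 := by
      rw [Ne, posPart_eq_zero, sub_nonpos]
      exact hcon
    have hv : (y - ε • e)⁻ ≠ 0 := by
      rw [Ne, negPart_eq_zero, sub_nonneg]
      intro h
      -- A vanishing negative part means `ε • e ≤ y`, so `(t + ε) • e ≤ x`, against the maximality
      -- of `t`.
      have := htm (t + ε) (by
        rw [add_smul, add_comm, ← le_sub_iff_add_le]; exact h)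
      linarith
    set u := (y - ε • e)⁺
    set v := (y - ε • e)⁻
    have hu0 : 0 ≤ u := posPart_nonneg _
    have hv0 : 0 ≤ v := negPart_nonneg _
    have hεe : 0 ≤ ε • e := smul_nonneg hε.le he0
    have hue : u ≤ e := sup_le ((sub_le_self _ hεe).trans hye) he0
    have hve : v ≤ ε • e := sup_le (by rw [neg_sub]; exact sub_le_self _ hy0) hεe
    have huv : u ⊓ v = 0 := posPart_inf_negPart_eq_zero _
    have hwe : ∀ w ∈ s.erase e, 0 ≤ w ∧ w ≠ 0 ∧ u ⊓ w = 0 ∧ v ⊓ w = 0 := by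
      intro w hw
      obtain ⟨hne, hws⟩ := Finset.mem_erase.mp hw
      have hw0 := (hs.1 w hws).1
      have hew : e ⊓ w = 0 := hs.2 e he w hws hne.symm
      exact ⟨hw0, (hs.1 w hws).2, inf_eq_zero_of_le hu0 hw0 hue hew,
        inf_eq_zero_of_le hv0 hw0 hve (smul_inf_eq_zero_of_nonneg he0 hw0 hew hε.le)⟩
    have hvn : v ∉ s.erase e := fun h => hv (by simpa using (hwe v h).2.2.2)
    have hun : u ∉ insert v (s.erase e) := by
      rw [Finset.mem_insert]
      rintro (h | h)
      · exact hu (by rw [← h, inf_idem] at huv; exact huv)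
      · exact hu (by simpa using (hwe u h).2.2.1)
    have hnew : IsDisjointPositive (insert u (insert v (s.erase e))) := by
      constructor
      · intro w hw
        simp only [Finset.mem_insert] at hw
        rcases hw with rfl | rfl | hw
        · exact ⟨hu0, hu⟩
        · exact ⟨hv0, hv⟩
        · exact ⟨(hwe w hw).1, (hwe w hw).2.1⟩
      · intro a ha b hb hab
        simp only [Finset.mem_insert] at ha hb
        rcases ha with rfl | rfl | ha <;> rcases hb with rfl | rfl | hb
        · exact absurd rfl hab
        · exact huv
        · exact (hwe b hb).2.2.1
        · rw [inf_comm]; exact huv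
        · exact absurd rfl hab
        · exact (hwe b hb).2.2.2
        · rw [inf_comm]; exact (hwe a ha).2.2.1
        · rw [inf_comm]; exact (hwe a ha).2.2.2
        · exact hs.2 a (Finset.mem_of_mem_erase ha) b (Finset.mem_of_mem_erase hb) hab
    have := hmax _ hnew
    rw [Finset.card_insert_of_notMem hun, Finset.card_insert_of_notMem hvn,
      Finset.card_erase_of_mem he] at this
    have hpos : 0 < s.card := Finset.card_pos.mpr ⟨e, he⟩
    omega
  have hy00 : y ≤ 0 := by
    have hlim : Filter.Tendsto (fun ε : ℝ => ε • e) (nhdsWithin 0 (Set.Ioi 0)) (nhds ((0 : ℝ) • e)) :=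
      ((continuous_id.smul continuous_const).tendsto (0 : ℝ)).mono_left nhdsWithin_le_nhds
    rw [zero_smul] at hlim
    exact ge_of_tendsto hlim (by filter_upwards [self_mem_nhdsWithin] with ε hε using key ε hε)
  exact sub_eq_zero.mp (le_antisymm hy00 hy0)

/-- Removing from a positive `x` the largest multiple of each member in turn leaves a vector
disjoint from all of `s`; if nonzero, it could be added to `s`. -/
theorem mem_span_of_maximal {s : Finset E} (hs : IsDisjointPositive s)
    (hmax : ∀ t : Finset E, IsDisjointPositive t → t.card ≤ s.card) (x : E) :
    x ∈ Submodule.span ℝ (s : Set E) := by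
  classical
  suffices H : ∀ x : E, 0 ≤ x → x ∈ Submodule.span ℝ (s : Set E) by
    rw [← posPart_sub_negPart x]
    exact Submodule.sub_mem _ (H _ (posPart_nonneg x)) (H _ (negPart_nonneg x))
  intro x hx
  have step : ∀ s' : Finset E, s' ⊆ s → ∃ y ∈ Submodule.span ℝ (s : Set E), 0 ≤ x - y ∧
      ∀ e ∈ s', (x - y) ⊓ e = 0 := by
    intro s'
    induction s' using Finset.induction_on with
    | empty => exact fun _ => ⟨0, Submodule.zero_mem _, by simpa using hx, by simp⟩
    | insert e s' he ih =>
      intro hsub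
      obtain ⟨y, hy, hxy, hdis⟩ := ih ((Finset.subset_insert _ _).trans hsub)
      have hes : e ∈ s := hsub (Finset.mem_insert_self _ _)
      have he0 := (hs.1 e hes).1
      obtain ⟨t, ht0, htx, htm⟩ := exists_max_smul_le hxy he0 (hs.1 e hes).2
      have h0 : 0 ≤ x - (y + t • e) := by rw [← sub_sub]; exact sub_nonneg.mpr htx
      refine ⟨y + t • e, Submodule.add_mem _ hy
        (Submodule.smul_mem _ _ (Submodule.subset_span hes)), h0, ?_⟩
      intro w hw
      rcases Finset.mem_insert.mp hw with rfl | hw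
      -- The meet of the new remainder with the atom `w` is some `c • w`, and `c > 0` would
      -- contradict the maximality of `t`.
      · obtain ⟨c, hc⟩ := eq_smul_of_le_of_maximal hs hmax hes (le_inf h0 he0) inf_le_right
        have hc1 : c • w ≤ x - (y + t • w) := hc ▸ inf_le_left
        have hc2 := htm (t + c) (by
          rw [← sub_sub, le_sub_iff_add_le] at hc1
          rwa [add_smul, add_comm])
        have hc0 : c • w ≤ 0 := smul_nonpos_of_nonpos_of_nonneg (by linarith) he0
        exact le_antisymm (hc.le.trans hc0) (le_inf h0 he0)
      · have hw0 := (hs.1 w (hsub (Finset.mem_insert_of_mem hw))).1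
        refine inf_eq_zero_of_le h0 hw0 ?_ (hdis w hw)
        rw [← sub_sub]
        exact sub_le_self _ (smul_nonneg ht0 he0)
  obtain ⟨y, hy, hxy, hdis⟩ := step s subset_rfl
  by_cases hz : x - y = 0
  · rwa [sub_eq_zero.mp hz]
  · exfalso
    have hn : x - y ∉ s := fun h => hz (by simpa using hdis _ h)
    have hnew : IsDisjointPositive (insert (x - y) s) := by
      constructor
      · intro w hw
        rcases Finset.mem_insert.mp hw with rfl | hw
        · exact ⟨hxy, hz⟩
        · exact hs.1 w hw
      · intro a ha b hb hab
        rcases Finset.mem_insert.mp ha with rfl | ha <;>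
          rcases Finset.mem_insert.mp hb with rfl | hb
        · exact absurd rfl hab
        · exact hdis b hb
        · rw [inf_comm]; exact hdis a ha
        · exact hs.2 a ha b hb hab
    have := hmax _ hnew
    rw [Finset.card_insert_of_notMem hn] at this
    omega

/-- A finite-dimensional normed vector lattice is spanned by finitely many pairwise disjoint
normalized atoms. -/
theorem exists_atoms (E : Type*) [NormedAddCommGroup E] [NormedSpace ℝ E]
    [Lattice E] [HasSolidNorm E] [IsOrderedAddMonoid E] [IsOrderedModule ℝ E]
    [FiniteDimensional ℝ E] :
    ∃ (n : ℕ) (e : Fin n → E), (∀ i, 0 ≤ e i) ∧ (∀ i, ‖e i‖ = 1) ∧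
      (Pairwise fun i j => e i ⊓ e j = 0) ∧
      (∀ i, ∀ x : E, 0 ≤ x → x ≤ e i → ∃ t : ℝ, x = t • e i) ∧
      Submodule.span ℝ (Set.range e) = ⊤ := by
  classical
  obtain ⟨s, hs, hmax⟩ := exists_maximal_isDisjointPositive E
  let τ := s.equivFin.symm
  have hm : ∀ i, (τ i : E) ∈ s := fun i => (τ i).2
  have hn : ∀ i, 0 < ‖(τ i : E)‖ := fun i => norm_pos_iff.mpr (hs.1 _ (hm i)).2
  refine ⟨s.card, fun i => ‖(τ i : E)‖⁻¹ • (τ i : E), ?_, ?_, ?_, ?_, ?_⟩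
  · exact fun i => smul_nonneg (inv_nonneg.mpr (hn i).le) (hs.1 _ (hm i)).1
  · intro i
    rw [norm_smul, norm_inv, norm_norm, inv_mul_cancel₀ (hn i).ne']
  · intro i j hij
    have hne : (τ i : E) ≠ (τ j : E) := fun h => hij (τ.injective (Subtype.ext h))
    have h := hs.2 _ (hm i) _ (hm j) hne
    have hi0 := (hs.1 _ (hm i)).1
    have hj0 := (hs.1 _ (hm j)).1
    have h1 := smul_inf_eq_zero_of_nonneg hi0 hj0 h (inv_nonneg.mpr (hn i).le)
    rw [inf_comm] at h1
    have h2 := smul_inf_eq_zero_of_nonneg hj0 (smul_nonneg (inv_nonneg.mpr (hn i).le) hi0) h1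
      (inv_nonneg.mpr (hn j).le)
    rwa [inf_comm] at h2
  · intro i x hx hxi
    have hi0 := (hs.1 _ (hm i)).1
    have h1 : ‖(τ i : E)‖ • x ≤ τ i := by rwa [← le_inv_smul_iff_of_pos (hn i)]
    obtain ⟨t, ht⟩ := eq_smul_of_le_of_maximal hs hmax (hm i) (smul_nonneg (hn i).le hx) h1
    refine ⟨t, ?_⟩
    rw [smul_comm, ← ht, smul_smul, inv_mul_cancel₀ (hn i).ne', one_smul]
  · rw [eq_top_iff]
    intro x _
    have := mem_span_of_maximal hs hmax x
    refine (Submodule.span_le.mpr ?_) this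
    intro y hy
    obtain ⟨i, hi⟩ := τ.surjective ⟨y, hy⟩
    have : y = ‖(τ i : E)‖ • (‖(τ i : E)‖⁻¹ • (τ i : E)) := by
      rw [smul_smul, mul_inv_cancel₀ (hn i).ne', one_smul, hi]
    rw [this]
    exact Submodule.smul_mem _ _ (Submodule.subset_span ⟨i, rfl⟩)

end VectorLattice

/-! ### Norms and strict monotonicity in $L_p$ -/

section LpNorm

variable {α : Type*} [MeasurableSpace α] {μ : Measure α} {V : Type*} [NormedAddCommGroup V]
  {p : ℝ≥0∞}

theorem toReal_pos_of_fact [Fact (1 ≤ p)] (hp : p ≠ ∞) : 0 < p.toReal :=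
  ENNReal.toReal_pos (zero_lt_one.trans_le Fact.out).ne' hp

theorem Lp_norm_rpow_eq_integral [Fact (1 ≤ p)] (hp : p ≠ ∞) (f : Lp V p μ) :
    ‖f‖ ^ p.toReal = ∫ x, ‖f x‖ ^ p.toReal ∂μ := by
  have hp0 : p ≠ 0 := (zero_lt_one.trans_le Fact.out).ne'
  have h0 : 0 ≤ ∫ x, ‖f x‖ ^ p.toReal ∂μ := integral_nonneg fun x => by positivity
  rw [Lp.norm_def, (Lp.memLp f).eLpNorm_eq_integral_rpow_norm hp0 hp,
    ENNReal.toReal_ofReal (by positivity), ← Real.rpow_mul h0,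
    inv_mul_cancel₀ (toReal_pos_of_fact hp).ne', Real.rpow_one]

theorem Lp_integrable_norm_rpow [Fact (1 ≤ p)] (hp : p ≠ ∞) (f : Lp V p μ) :
    Integrable (fun x => ‖f x‖ ^ p.toReal) μ :=
  (Lp.memLp f).integrable_norm_rpow (zero_lt_one.trans_le Fact.out).ne' hp

/-- For finite `p` the nonnegative function `‖v‖ ^ p - ‖u‖ ^ p` has integral zero, so it vanishes
almost everywhere. -/
theorem Lp_ae_eq_of_le_of_norm_eq [Fact (1 ≤ p)] (hp : p ≠ ∞) {u v : Lp ℝ p μ} (hu : 0 ≤ u)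
    (huv : u ≤ v) (h : ‖u‖ = ‖v‖) : u = v := by
  have hint : ∫ x, (‖v x‖ ^ p.toReal - ‖u x‖ ^ p.toReal) ∂μ = 0 := by
    rw [integral_sub (Lp_integrable_norm_rpow hp v) (Lp_integrable_norm_rpow hp u),
      ← Lp_norm_rpow_eq_integral hp, ← Lp_norm_rpow_eq_integral hp, h, sub_self]
  have hr := toReal_pos_of_fact (p := p) hp
  have hle : ∀ᵐ x ∂μ, 0 ≤ u x ∧ u x ≤ v x := by
    filter_upwards [(Lp.coeFn_nonneg u).mpr hu, (Lp.coeFn_le u v).mpr huv] with x h1 h2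
    exact ⟨h1, h2⟩
  rw [integral_eq_zero_iff_of_nonneg_ae] at hint
  · apply Lp.ext
    filter_upwards [hint, hle] with x h1 ⟨h2, h3⟩
    have h4 := h2.trans h3
    simp only [Pi.zero_apply, Real.norm_of_nonneg h2, Real.norm_of_nonneg h4] at h1
    exact (Real.rpow_left_inj h2 h4 hr.ne').mp (sub_eq_zero.mp h1).symm
  · filter_upwards [hle] with x ⟨h2, h3⟩
    have h4 := h2.trans h3
    simp only [Pi.zero_apply, Real.norm_of_nonneg h2, Real.norm_of_nonneg h4, sub_nonneg]
    exact Real.rpow_le_rpow h2 h3 hr.le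
  · exact (Lp_integrable_norm_rpow hp v).sub (Lp_integrable_norm_rpow hp u)

end LpNorm

/-! ### Random norms of atoms -/

namespace AbstractLpLq

variable {p q : ℝ≥0∞} {Ω : Type*} [MeasurableSpace Ω] {μ : Measure Ω} {X : Type*}
  [NormedAddCommGroup X] [NormedSpace ℝ X] [Lattice X] (A : AbstractLpLq p q μ X)

theorem N_zero [Fact (1 ≤ p)] : A.N 0 = 0 := by
  rw [← norm_eq_zero, ← A.norm_eq, norm_zero]

/-- The indicator function of a measurable set as an element of `L_∞`. -/
noncomputable def ind (μ : Measure Ω) {B : Set Ω} (hB : MeasurableSet B) : Lp ℝ ∞ μ :=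
  ((memLp_top_const (1 : ℝ)).indicator hB).toLp _

theorem ind_ae (μ : Measure Ω) {B : Set Ω} (hB : MeasurableSet B) :
    ind μ hB =ᵐ[μ] B.indicator fun _ => (1 : ℝ) :=
  MemLp.coeFn_toLp _

theorem ind_nonneg (μ : Measure Ω) {B : Set Ω} (hB : MeasurableSet B) : 0 ≤ ind μ hB := by
  rw [← Lp.coeFn_nonneg]
  filter_upwards [ind_ae μ hB] with x hx
  rw [hx]
  exact Set.indicator_nonneg (fun _ _ => zero_le_one) x

theorem act_ind_add_compl {B : Set Ω} (hB : MeasurableSet B) (x : X) :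
    A.act (ind μ hB) x + A.act (ind μ hB.compl) x = x := by
  rw [← LinearMap.add_apply, ← map_add]
  apply A.act_one
  filter_upwards [Lp.coeFn_add (ind μ hB) (ind μ hB.compl), ind_ae μ hB, ind_ae μ hB.compl]
    with ω h1 h2 h3
  rw [h1, Pi.add_apply, h2, h3]
  by_cases h : ω ∈ B <;> simp [h]

theorem act_ind_act_ind {B : Set Ω} (hB : MeasurableSet B) (x : X) :
    A.act (ind μ hB) (A.act (ind μ hB) x) = A.act (ind μ hB) x := by
  refine (A.act_mul _ _ _ ?_ x).symm
  filter_upwards [ind_ae μ hB] with ω h2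
  rw [h2]
  by_cases h : ω ∈ B <;> simp [h]

/-- The random norm of an atom is supported in an atom of the measure space. -/
theorem N_atom [Fact (1 ≤ p)] [IsOrderedAddMonoid X] {x : X} (hx : 0 ≤ x)
    (hat : ∀ y, 0 ≤ y → y ≤ x → ∃ t : ℝ, y = t • x) {B : Set Ω} (hB : MeasurableSet B) :
    (∀ᵐ ω ∂μ, ω ∈ B → A.N x ω = 0) ∨ (∀ᵐ ω ∂μ, ω ∉ B → A.N x ω = 0) := by
  have h0 := A.act_nonneg _ (ind_nonneg μ hB) x hx
  have h1 := A.act_nonneg _ (ind_nonneg μ hB.compl) x hx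
  obtain ⟨t, ht⟩ := hat _ h0 (by
    conv_rhs => rw [← A.act_ind_add_compl hB x]
    exact le_add_of_nonneg_right h1)
  -- An indicator acts idempotently, so `t * t = t` unless `x = 0`. The value 0 kills the random
  -- norm on `B`, the value 1 kills it off `B`.
  have h2 := A.act_ind_act_ind hB x
  rw [ht, map_smul, ht, smul_smul, ← sub_eq_zero, ← sub_smul, smul_eq_zero] at h2
  rcases h2 with h2 | h2
  · have h3 : t * (t - 1) = 0 := by linarith
    rcases mul_eq_zero.mp h3 with h3 | h3
    · left
      rw [h3, zero_smul] at ht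
      have h4 := A.N_act (ind μ hB) x
      rw [ht, A.N_zero] at h4
      filter_upwards [h4, ind_ae μ hB, Lp.coeFn_zero ℝ p μ] with ω h4 h5 h6 h7
      rw [h5, h6] at h4
      simpa [h7] using h4.symm
    · right
      have h3 : t = 1 := by linarith
      rw [h3, one_smul] at ht
      have h4 := A.N_act (ind μ hB) x
      rw [ht] at h4
      filter_upwards [h4, ind_ae μ hB] with ω h4 h5 h7
      rw [h4, h5]
      simp [h7]
  · left
    rw [h2, A.N_zero]
    filter_upwards [Lp.coeFn_zero ℝ p μ] with ω h6 _
    exact h6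

/-- `N_atom` is tested on `{N x < N y}`, on `{N y < N x}` and on the common support. If `N x` or `N
y` lives on the set where it is the smaller one, the two are comparable, and equal norms make them
equal. Otherwise each vanishes where it is smaller, and the common support decides between
disjointness and comparability. -/
theorem N_atoms_eq_or_disjoint [Fact (1 ≤ p)] [IsOrderedAddMonoid X] (hp : p ≠ ∞) {x y : X}
    (hx : 0 ≤ x) (hy : 0 ≤ y) (hxa : ∀ z, 0 ≤ z → z ≤ x → ∃ t : ℝ, z = t • x)
    (hya : ∀ z, 0 ≤ z → z ≤ y → ∃ t : ℝ, z = t • y) (hxy : ‖x‖ = ‖y‖) :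
    A.N x = A.N y ∨ ∀ᵐ ω ∂μ, A.N x ω = 0 ∨ A.N y ω = 0 := by
  have hn : ‖A.N x‖ = ‖A.N y‖ := by rw [← A.norm_eq, ← A.norm_eq, hxy]
  have hmx := (Lp.stronglyMeasurable (A.N x)).measurable
  have hmy := (Lp.stronglyMeasurable (A.N y)).measurable
  have px := (Lp.coeFn_nonneg _).mpr (A.N_nonneg x)
  have py := (Lp.coeFn_nonneg _).mpr (A.N_nonneg y)
  have e1 : (∀ᵐ ω ∂μ, A.N x ω ≤ A.N y ω) → A.N x = A.N y := fun h =>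
    Lp_ae_eq_of_le_of_norm_eq hp (A.N_nonneg x) ((Lp.coeFn_le _ _).mp h) hn
  have e2 : (∀ᵐ ω ∂μ, A.N y ω ≤ A.N x ω) → A.N x = A.N y := fun h =>
    (Lp_ae_eq_of_le_of_norm_eq hp (A.N_nonneg y) ((Lp.coeFn_le _ _).mp h) hn.symm).symm
  rcases A.N_atom hx hxa (measurableSet_lt hmx hmy) with h1 | h1
  swap
  · left; apply e1
    filter_upwards [h1, py] with ω h1 h2
    by_contra h
    rw [h1 (by simpa using (le_of_not_ge h))] at h
    exact h h2
  rcases A.N_atom hy hya (measurableSet_lt hmy hmx) with h2 | h2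
  swap
  · left; apply e2
    filter_upwards [h2, px] with ω h1 h2
    by_contra h
    rw [h1 (by simpa using (le_of_not_ge h))] at h
    exact h h2
  rcases A.N_atom hx hxa ((measurableSet_lt measurable_const hmx).inter
    (measurableSet_lt measurable_const hmy) : MeasurableSet ({ω | 0 < A.N x ω} ∩ {ω | 0 < A.N y ω}))
    with h3 | h3
  · right
    filter_upwards [h3, px, py] with ω h3 h4 h5
    rcases h4.lt_or_eq with h4 | h4
    · rcases h5.lt_or_eq with h5 | h5
      · exact Or.inl (h3 ⟨h4, h5⟩)
      · exact Or.inr h5.symm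
    · exact Or.inl h4.symm
  · left; apply e1
    filter_upwards [h1, h2, h3, px, py] with ω h1 h2 h3 h4 h5
    by_contra h
    push Not at h
    have h6 := h2 h
    have h7 := h3 (fun h8 => h8.2.ne' h6)
    rw [h7, h6] at h
    exact lt_irrefl _ h

/-- Equal random norms give `N (x + y) = 2 ^ (1 / q) • N x`; disjoint ones make `N (x + y) ^ p` the
sum of the two `p`-th powers, which is then integrated. -/
theorem norm_add_atoms (A : AbstractLpLq p q μ X) [Fact (1 ≤ p)] [Fact (1 ≤ q)] [IsOrderedAddMonoid X] (hp : p ≠ ∞)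
    (hq : q ≠ ∞) {x y : X} (hx : 0 ≤ x) (hy : 0 ≤ y)
    (hxa : ∀ z, 0 ≤ z → z ≤ x → ∃ t : ℝ, z = t • x)
    (hya : ∀ z, 0 ≤ z → z ≤ y → ∃ t : ℝ, z = t • y) (hx1 : ‖x‖ = 1) (hy1 : ‖y‖ = 1)
    (hd : x ⊓ y = 0) :
    ‖x + y‖ ^ q.toReal = 2 ∨ ‖x + y‖ ^ p.toReal = 2 := by
  have hq0 := toReal_pos_of_fact (p := q) hq
  have hp0 := toReal_pos_of_fact (p := p) hp
  have hadd := A.N_add_of_disjoint x y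
    (by rw [LatticeDisjoint, abs_of_nonneg hx, abs_of_nonneg hy, hd])
  have px := (Lp.coeFn_nonneg _).mpr (A.N_nonneg x)
  have py := (Lp.coeFn_nonneg _).mpr (A.N_nonneg y)
  have pxy := (Lp.coeFn_nonneg _).mpr (A.N_nonneg (x + y))
  rcases A.N_atoms_eq_or_disjoint hp hx hy hxa hya (hx1.trans hy1.symm) with h | h
  · left
    have h1 : A.N (x + y) = (2 : ℝ) ^ (q.toReal)⁻¹ • A.N x := by
      apply Lp.ext
      filter_upwards [hadd, px, pxy, Lp.coeFn_smul ((2 : ℝ) ^ (q.toReal)⁻¹) (A.N x)]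
        with ω h1 h2 h3 h4
      simp only [Pi.zero_apply] at h2 h3
      rw [h4, Pi.smul_apply, smul_eq_mul, ← Real.rpow_left_inj h3 (by positivity) hq0.ne', h1, ← h,
        Real.mul_rpow (by positivity) h2, ← Real.rpow_mul zero_le_two, inv_mul_cancel₀ hq0.ne',
        Real.rpow_one]
      ring
    rw [A.norm_eq, h1, norm_smul, ← A.norm_eq, hx1, mul_one, Real.norm_of_nonneg (by positivity),
      ← Real.rpow_mul zero_le_two, inv_mul_cancel₀ hq0.ne', Real.rpow_one]
  · right
    rw [A.norm_eq, Lp_norm_rpow_eq_integral hp]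
    have h1 : ∀ᵐ ω ∂μ, ‖A.N (x + y) ω‖ ^ p.toReal =
        ‖A.N x ω‖ ^ p.toReal + ‖A.N y ω‖ ^ p.toReal := by
      filter_upwards [hadd, px, py, pxy, h] with ω h1 h2 h3 h4 h5
      simp only [Pi.zero_apply] at h2 h3 h4
      rw [Real.norm_of_nonneg h2, Real.norm_of_nonneg h3, Real.norm_of_nonneg h4]
      rcases h5 with h5 | h5 <;> rw [h5] at h1 ⊢
      · rw [Real.zero_rpow hq0.ne', zero_add, Real.rpow_left_inj h4 h3 hq0.ne'] at h1
        rw [h1, Real.zero_rpow hp0.ne', zero_add]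
      · rw [Real.zero_rpow hq0.ne', add_zero, Real.rpow_left_inj h4 h2 hq0.ne'] at h1
        rw [h1, Real.zero_rpow hp0.ne', add_zero]
    rw [integral_congr_ae h1, integral_add (Lp_integrable_norm_rpow hp _)
      (Lp_integrable_norm_rpow hp _), ← Lp_norm_rpow_eq_integral hp, ← Lp_norm_rpow_eq_integral hp,
      ← A.norm_eq, ← A.norm_eq, hx1, hy1, Real.one_rpow]
    norm_num

end AbstractLpLq

namespace PreservesLattice

variable {X Y : Type*} [NormedAddCommGroup X] [NormedSpace ℝ X] [Lattice X]
  [NormedAddCommGroup Y] [NormedSpace ℝ Y] [Lattice Y] {f : X →ₗᵢ[ℝ] Y}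

theorem le_iff (hf : PreservesLattice f) {x y : X} : f x ≤ f y ↔ x ≤ y := by
  rw [← sup_eq_right, ← hf.map_sup, f.injective.eq_iff, sup_eq_right]

theorem nonneg_iff (hf : PreservesLattice f) {x : X} : 0 ≤ f x ↔ 0 ≤ x := by
  rw [← hf.le_iff, map_zero]

end PreservesLattice

/-- A band is solid, so everything between 0 and the image of an atom comes from `E`: atoms of `E`
remain atoms in the ambient lattice. -/
theorem IsBLpLq.norm_add_atoms {p q : ℝ≥0∞} [Fact (1 ≤ p)] [Fact (1 ≤ q)] (hp : p ≠ ∞)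
    (hq : q ≠ ∞) {E : Type*} [NormedAddCommGroup E] [NormedSpace ℝ E] [Lattice E]
    (hE : IsBLpLq p q E) {x y : E} (hx : 0 ≤ x) (hy : 0 ≤ y)
    (hxa : ∀ z, 0 ≤ z → z ≤ x → ∃ t : ℝ, z = t • x)
    (hya : ∀ z, 0 ≤ z → z ≤ y → ∃ t : ℝ, z = t • y) (hx1 : ‖x‖ = 1) (hy1 : ‖y‖ = 1)
    (hd : x ⊓ y = 0) :
    ‖x + y‖ ^ q.toReal = 2 ∨ ‖x + y‖ ^ p.toReal = 2 := by
  obtain ⟨X, _, _, _, _, _, _, _, Ω, _, μ, A, ι, hι, hb⟩ := hE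
  have hat : ∀ x : E, 0 ≤ x → (∀ z, 0 ≤ z → z ≤ x → ∃ t : ℝ, z = t • x) →
      ∀ z, 0 ≤ z → z ≤ ι x → ∃ t : ℝ, z = t • ι x := by
    intro x hx hxa z hz hzx
    have hmem : z ∈ LinearMap.range ι.toLinearMap :=
      hb.solid (x := ι x) ⟨x, rfl⟩ (by rw [abs_of_nonneg hz, abs_of_nonneg (hι.nonneg_iff.mpr hx)]; exact hzx)
    obtain ⟨y, rfl⟩ := hmem
    obtain ⟨t, rfl⟩ := hxa y (hι.nonneg_iff.mp hz) (hι.le_iff.mp hzx)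
    exact ⟨t, map_smul ι t x⟩
  rw [← ι.norm_map, map_add]
  exact A.norm_add_atoms hp hq (hι.nonneg_iff.mpr hx) (hι.nonneg_iff.mpr hy) (hat x hx hxa)
    (hat y hy hya) (by rw [ι.norm_map, hx1]) (by rw [ι.norm_map, hy1])
    (by rw [← hι.map_inf, hd, map_zero])

/-! ### Equality cases of power inequalities, and fibre norms of disjoint elements -/

/-- Strict concavity for `r < 1`, strict convexity for `r > 1`. The sign `s` lets `p < q` and `p >
q` be treated together, with `r = p / q`. -/
theorem rpow_midpoint_sign {r : ℝ} (hr0 : 0 < r) (hr1 : r ≠ 1) :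
    ∃ s : ℝ, ∀ u v : ℝ, 0 ≤ u → 0 ≤ v →
      0 ≤ s * (((u + v) / 2) ^ r - (u ^ r + v ^ r) / 2) ∧
      (s * (((u + v) / 2) ^ r - (u ^ r + v ^ r) / 2) = 0 → u = v) := by
  rcases lt_or_gt_of_ne hr1 with h | h
  · refine ⟨1, fun u v hu hv => ?_⟩
    by_cases huv : u = v
    · subst huv
      exact ⟨by simp, fun _ => rfl⟩
    · have := (Real.strictConcaveOn_rpow hr0 h).2 hu hv huv
        (by norm_num : (0 : ℝ) < 1 / 2) (by norm_num : (0 : ℝ) < 1 / 2) (by norm_num)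
      simp only [smul_eq_mul] at this
      rw [show 1 / 2 * u + 1 / 2 * v = (u + v) / 2 by ring] at this
      exact ⟨by linarith, fun h => by linarith⟩
  · refine ⟨-1, fun u v hu hv => ?_⟩
    by_cases huv : u = v
    · subst huv
      exact ⟨by simp, fun _ => rfl⟩
    · have := (strictConvexOn_rpow h).2 hu hv huv
        (by norm_num : (0 : ℝ) < 1 / 2) (by norm_num : (0 : ℝ) < 1 / 2) (by norm_num)
      simp only [smul_eq_mul] at this
      rw [show 1 / 2 * u + 1 / 2 * v = (u + v) / 2 by ring] at this
      exact ⟨by linarith, fun h => by linarith⟩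

/-- Write `u ^ r = u * u ^ (r - 1)`: strict monotonicity of `t ^ (r - 1)` on positive reals makes
the power strictly subadditive or strictly superadditive. -/
theorem rpow_add_sign {r : ℝ} (hr0 : 0 < r) (hr1 : r ≠ 1) :
    ∃ s : ℝ, ∀ u v : ℝ, 0 ≤ u → 0 ≤ v →
      0 ≤ s * ((u + v) ^ r - (u ^ r + v ^ r)) ∧
      (s * ((u + v) ^ r - (u ^ r + v ^ r)) = 0 → u = 0 ∨ v = 0) := by
  have key : ∀ u : ℝ, 0 < u → u ^ r = u * u ^ (r - 1) := by
    intro u hu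
    rw [mul_comm, ← Real.rpow_add_one hu.ne', sub_add_cancel]
  rcases lt_or_gt_of_ne hr1 with h | h
  · refine ⟨-1, fun u v hu hv => ?_⟩
    rcases hu.eq_or_lt with rfl | hu
    · simp [hr0.ne']
    rcases hv.eq_or_lt with rfl | hv
    · simp [hr0.ne']
    have h1 := mul_lt_mul_of_pos_left (Real.rpow_lt_rpow_of_neg hu (lt_add_of_pos_right u hv)
      (sub_neg.mpr h)) hu
    have h2 := mul_lt_mul_of_pos_left (Real.rpow_lt_rpow_of_neg hv (lt_add_of_pos_left v hu)
      (sub_neg.mpr h)) hv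
    rw [key u hu, key v hv, key (u + v) (by linarith)]
    constructor
    · linarith
    · intro; linarith
  · refine ⟨1, fun u v hu hv => ?_⟩
    rcases hu.eq_or_lt with rfl | hu
    · simp [hr0.ne']
    rcases hv.eq_or_lt with rfl | hv
    · simp [hr0.ne']
    have h1 := mul_lt_mul_of_pos_left (Real.rpow_lt_rpow hu.le (lt_add_of_pos_right u hv)
      (sub_pos.mpr h)) hu
    have h2 := mul_lt_mul_of_pos_left (Real.rpow_lt_rpow hv.le (lt_add_of_pos_left v hu)
      (sub_pos.mpr h)) hv
    rw [key u hu, key v hv, key (u + v) (by linarith)]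
    constructor
    · linarith
    · intro; linarith

section

variable {Y Z : Type*} [MeasurableSpace Y] [MeasurableSpace Z] {ν : Measure Y} {ρ : Measure Z}
  {p q : ℝ≥0∞} [Fact (1 ≤ p)] [Fact (1 ≤ q)]

theorem Lp_disjoint_ae {f g : Lp ℝ q ν} (h : f ⊓ g = 0) :
    ∀ᵐ y ∂ν, f y ⊓ g y = 0 := by
  filter_upwards [Lp.coeFn_inf f g, Lp.coeFn_zero ℝ q ν] with y h1 h2
  rw [h, h2] at h1
  exact h1.symm

theorem norm_add_rpow_of_disjoint (hq : q ≠ ∞) {f g : Lp ℝ q ν} (hf : 0 ≤ f) (hg : 0 ≤ g)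
    (h : f ⊓ g = 0) :
    ‖f + g‖ ^ q.toReal = ‖f‖ ^ q.toReal + ‖g‖ ^ q.toReal := by
  have hq0 := toReal_pos_of_fact (p := q) hq
  rw [Lp_norm_rpow_eq_integral hq, Lp_norm_rpow_eq_integral hq, Lp_norm_rpow_eq_integral hq,
    ← integral_add (Lp_integrable_norm_rpow hq _) (Lp_integrable_norm_rpow hq _)]
  apply integral_congr_ae
  filter_upwards [Lp_disjoint_ae h, Lp.coeFn_add f g, (Lp.coeFn_nonneg f).mpr hf,
    (Lp.coeFn_nonneg g).mpr hg] with y h1 h2 h3 h4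
  simp only [Pi.zero_apply] at h3 h4
  simp only [h2, Pi.add_apply]
  rcases le_total (f y) (g y) with h5 | h5
  · rw [inf_eq_left.mpr h5] at h1
    simp [h1, hq0.ne']
  · rw [inf_eq_right.mpr h5] at h1
    simp [h1, hq0.ne']

theorem fibre_inf_eq_zero {f g : Lp (Lp ℝ q ν) p ρ} (h : f ⊓ g = 0) :
    ∀ᵐ z ∂ρ, f z ⊓ g z = 0 := by
  filter_upwards [Lp.coeFn_inf f g, Lp.coeFn_zero (Lp ℝ q ν) p ρ] with y h1 h2
  rw [h, h2] at h1
  exact h1.symm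

theorem fibre_norm_add_rpow (hq : q ≠ ∞) {f g : Lp (Lp ℝ q ν) p ρ} (hf : 0 ≤ f)
    (hg : 0 ≤ g) (h : f ⊓ g = 0) :
    ∀ᵐ z ∂ρ, ‖(f + g) z‖ ^ p.toReal =
      (‖f z‖ ^ q.toReal + ‖g z‖ ^ q.toReal) ^ (p.toReal / q.toReal) := by
  have hq0 := toReal_pos_of_fact (p := q) hq
  filter_upwards [fibre_inf_eq_zero h, Lp.coeFn_add f g, (Lp.coeFn_nonneg f).mpr hf,
    (Lp.coeFn_nonneg g).mpr hg] with z h1 h2 h3 h4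
  rw [h2, Pi.add_apply, ← norm_add_rpow_of_disjoint hq h3 h4 h1, ← Real.rpow_mul (norm_nonneg _),
    mul_div_cancel₀ _ hq0.ne']

theorem rpow_rpow_div (hq : q ≠ ∞) {a : ℝ} (ha : 0 ≤ a) :
    (a ^ q.toReal) ^ (p.toReal / q.toReal) = a ^ p.toReal := by
  rw [← Real.rpow_mul ha, mul_div_cancel₀ _ (toReal_pos_of_fact (p := q) hq).ne']

theorem toReal_div_ne_one (hp : p ≠ ∞) (hq : q ≠ ∞) (hpq : p ≠ q) :
    p.toReal / q.toReal ≠ 1 := by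
  rw [Ne, div_eq_one_iff_eq (toReal_pos_of_fact (p := q) hq).ne', ENNReal.toReal_eq_toReal_iff' hp hq]
  exact hpq

/-- If two disjoint normalized positive elements span a copy of `ℓ_q^2`, then their fibre norms
agree. -/
theorem fibre_norm_eq_of_norm_add (hp : p ≠ ∞) (hq : q ≠ ∞) (hpq : p ≠ q)
    {f g : Lp (Lp ℝ q ν) p ρ} (hf : 0 ≤ f) (hg : 0 ≤ g) (h : f ⊓ g = 0) (hf1 : ‖f‖ = 1)
    (hg1 : ‖g‖ = 1) (hfg : ‖f + g‖ ^ q.toReal = 2) : ∀ᵐ z ∂ρ, ‖f z‖ = ‖g z‖ := by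
  have hp0 := toReal_pos_of_fact (p := p) hp
  have hq0 := toReal_pos_of_fact (p := q) hq
  obtain ⟨s, hs⟩ := rpow_midpoint_sign (div_pos hp0 hq0) (toReal_div_ne_one hp hq hpq)
  have hi1 := (Lp_integrable_norm_rpow hp (f + g)).const_mul (((1 : ℝ) / 2) ^ (p.toReal / q.toReal))
  have hi2 : Integrable (fun z => 1 / 2 * (‖f z‖ ^ p.toReal + ‖g z‖ ^ p.toReal)) ρ :=
    ((Lp_integrable_norm_rpow hp f).add (Lp_integrable_norm_rpow hp g)).const_mul (1 / 2)
  have hint : Integrable (fun z => s * ((1 / 2) ^ (p.toReal / q.toReal) * ‖(f + g) z‖ ^ p.toReal -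
      1 / 2 * (‖f z‖ ^ p.toReal + ‖g z‖ ^ p.toReal))) ρ := (hi1.sub hi2).const_mul s
  -- The integrated midpoint defect vanishes: `‖f + g‖ ^ p = 2 ^ (p / q)` cancels the factor `(1 /
  -- 2) ^ (p / q)`, leaving `1 - (1 + 1) / 2`.
  have hI : ∫ z, s * ((1 / 2) ^ (p.toReal / q.toReal) * ‖(f + g) z‖ ^ p.toReal -
      1 / 2 * (‖f z‖ ^ p.toReal + ‖g z‖ ^ p.toReal)) ∂ρ = 0 := by
    rw [integral_const_mul]
    rw [integral_sub hi1 hi2, integral_const_mul, integral_const_mul]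
    rw [integral_add (Lp_integrable_norm_rpow hp f) (Lp_integrable_norm_rpow hp g)]
    rw [← Lp_norm_rpow_eq_integral hp, ← Lp_norm_rpow_eq_integral hp,
      ← Lp_norm_rpow_eq_integral hp, hf1, hg1, ← rpow_rpow_div hq (norm_nonneg (f + g)), hfg,
      ← Real.mul_rpow (by norm_num) (by norm_num)]
    norm_num
  have heq : ∀ᵐ z ∂ρ, s * ((1 / 2) ^ (p.toReal / q.toReal) * ‖(f + g) z‖ ^ p.toReal -
      1 / 2 * (‖f z‖ ^ p.toReal + ‖g z‖ ^ p.toReal)) =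
      s * (((‖f z‖ ^ q.toReal + ‖g z‖ ^ q.toReal) / 2) ^ (p.toReal / q.toReal) -
      ((‖f z‖ ^ q.toReal) ^ (p.toReal / q.toReal) +
        (‖g z‖ ^ q.toReal) ^ (p.toReal / q.toReal)) / 2) := by
    filter_upwards [fibre_norm_add_rpow hq hf hg h] with z hz
    rw [hz, rpow_rpow_div hq (norm_nonneg _), rpow_rpow_div hq (norm_nonneg _),
      ← Real.mul_rpow (by norm_num) (by positivity)]
    ring_nf
  rw [integral_eq_zero_iff_of_nonneg_ae _ hint] at hI
  · filter_upwards [hI, heq] with z h1 h2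
    simp only [Pi.zero_apply] at h1
    rw [h1] at h2
    exact (Real.rpow_left_inj (norm_nonneg _) (norm_nonneg _) hq0.ne').mp
      ((hs _ _ (by positivity) (by positivity)).2 h2.symm)
  · filter_upwards [heq] with z h2
    rw [h2]
    exact (hs _ _ (by positivity) (by positivity)).1

/-- If two disjoint normalized positive elements span a copy of `ℓ_p^2`, then their fibre norms
are disjoint. -/
theorem fibre_disjoint_of_norm_add (hp : p ≠ ∞) (hq : q ≠ ∞) (hpq : p ≠ q)
    {f g : Lp (Lp ℝ q ν) p ρ} (hf : 0 ≤ f) (hg : 0 ≤ g) (h : f ⊓ g = 0) (hf1 : ‖f‖ = 1)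
    (hg1 : ‖g‖ = 1) (hfg : ‖f + g‖ ^ p.toReal = 2) : ∀ᵐ z ∂ρ, f z = 0 ∨ g z = 0 := by
  have hp0 := toReal_pos_of_fact (p := p) hp
  have hq0 := toReal_pos_of_fact (p := q) hq
  obtain ⟨s, hs⟩ := rpow_add_sign (div_pos hp0 hq0) (toReal_div_ne_one hp hq hpq)
  have hi1 := Lp_integrable_norm_rpow hp (f + g)
  have hi2 : Integrable (fun z => ‖f z‖ ^ p.toReal + ‖g z‖ ^ p.toReal) ρ :=
    (Lp_integrable_norm_rpow hp f).add (Lp_integrable_norm_rpow hp g)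
  have hint : Integrable (fun z => s * (‖(f + g) z‖ ^ p.toReal -
      (‖f z‖ ^ p.toReal + ‖g z‖ ^ p.toReal))) ρ := (hi1.sub hi2).const_mul s
  -- The integrated additivity defect is `2 - (1 + 1)`.
  have hI : ∫ z, s * (‖(f + g) z‖ ^ p.toReal -
      (‖f z‖ ^ p.toReal + ‖g z‖ ^ p.toReal)) ∂ρ = 0 := by
    rw [integral_const_mul]
    rw [integral_sub hi1 hi2]
    rw [integral_add (Lp_integrable_norm_rpow hp f) (Lp_integrable_norm_rpow hp g)]
    rw [← Lp_norm_rpow_eq_integral hp, ← Lp_norm_rpow_eq_integral hp,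
      ← Lp_norm_rpow_eq_integral hp, hf1, hg1, hfg]
    norm_num
  have heq : ∀ᵐ z ∂ρ, s * (‖(f + g) z‖ ^ p.toReal -
      (‖f z‖ ^ p.toReal + ‖g z‖ ^ p.toReal)) =
      s * (((‖f z‖ ^ q.toReal + ‖g z‖ ^ q.toReal)) ^ (p.toReal / q.toReal) -
      ((‖f z‖ ^ q.toReal) ^ (p.toReal / q.toReal) +
        (‖g z‖ ^ q.toReal) ^ (p.toReal / q.toReal))) := by
    filter_upwards [fibre_norm_add_rpow hq hf hg h] with z hz
    rw [hz, rpow_rpow_div hq (norm_nonneg _), rpow_rpow_div hq (norm_nonneg _)]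
  rw [integral_eq_zero_iff_of_nonneg_ae _ hint] at hI
  · filter_upwards [hI, heq] with z h1 h2
    simp only [Pi.zero_apply] at h1
    rw [h1] at h2
    have h3 := (hs _ _ (by positivity) (by positivity)).2 h2.symm
    simpa [Real.rpow_eq_zero_iff_of_nonneg, hq0.ne'] using h3
  · filter_upwards [heq] with z h2
    rw [h2]
    exact (hs _ _ (by positivity) (by positivity)).1

end

/-! ### Transport to Lebesgue measure by distribution functions -/

/-- The distribution function of a measure on the unit interval transports an atomless probability
measure to Lebesgue measure. -/
theorem measurePreserving_distribution (μ : Measure I) [IsProbabilityMeasure μ]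
    [NullSingletonClass μ] {F : I → I} (hF : ∀ y, (F y : ℝ) = μ.real (Set.Iic y)) :
    Monotone F ∧ MeasurePreserving F μ volume := by
  have hmono : Monotone F := by
    intro a b hab
    rw [← Subtype.coe_le_coe, hF, hF]
    exact measureReal_mono (Set.Iic_subset_Iic.mpr hab)
  have hcont : Continuous F := by
    rw [continuous_induced_rng]
    have h1 : (Subtype.val ∘ F) = fun y => ∫ a, (Set.Iic y).indicator (fun _ => (1 : ℝ)) a ∂μ := by
      funext y
      rw [Function.comp_apply, hF, integral_indicator_const _ measurableSet_Iic, smul_eq_mul,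
        mul_one]
    rw [h1, continuous_iff_continuousAt]
    intro y
    -- Near `y`, the indicator of `Iic z` is locally constant in `z` at every point `a ≠ y`, and the
    -- singleton `{y}` is null; dominated convergence gives continuity.
    refine continuousAt_of_dominated (bound := fun _ => 1)
      (Filter.Eventually.of_forall fun z =>
        (aestronglyMeasurable_const.indicator measurableSet_Iic))
      (Filter.Eventually.of_forall fun z => Filter.Eventually.of_forall fun a => ?_)
      (integrable_const _) ?_
    · exact (norm_indicator_le_norm_self _ _).trans (by simp)
    · have : ∀ᵐ a ∂μ, a ≠ y := by
        rw [ae_iff]; simp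
      filter_upwards [this] with a ha
      rcases lt_or_gt_of_ne ha with h | h
      · refine ContinuousAt.congr (f := fun _ => (1 : ℝ)) continuousAt_const ?_
        filter_upwards [lt_mem_nhds h] with z hz
        rw [Set.indicator_of_mem (Set.mem_Iic.mpr hz.le)]
      · refine ContinuousAt.congr (f := fun _ => (0 : ℝ)) continuousAt_const ?_
        filter_upwards [gt_mem_nhds h] with z hz
        rw [Set.indicator_of_notMem (by simpa using hz)]
  refine ⟨hmono, hcont.measurable, ?_⟩
  have : IsFiniteMeasure (μ.map F) := Measure.isFiniteMeasure_map μ F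
  refine Measure.ext_of_Iic _ _ fun t => ?_
  rw [Measure.map_apply hcont.measurable measurableSet_Iic, unitInterval.volume_Iic]
  obtain ⟨y₀, hy₀⟩ : t ∈ Set.range F := by
    refine mem_range_of_exists_le_of_exists_ge hcont ⟨0, ?_⟩ ⟨1, ?_⟩
    · rw [← Subtype.coe_le_coe, hF]
      have : Set.Iic (0 : I) = {0} := by
        ext x; simp
      rw [this, measureReal_def, measure_singleton]
      exact t.2.1
    · rw [← Subtype.coe_le_coe, hF]
      have : Set.Iic (1 : I) = Set.univ := Set.eq_univ_of_forall fun x => x.2.2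
      rw [this, probReal_univ]
      exact t.2.2
  -- The preimage of `Iic t` is a compact lower set, hence `Iic y` for its greatest element `y`.
  -- There `F y = t`, so its measure is `t` by the definition of `F`.
  have hclosed : IsCompact (F ⁻¹' Set.Iic t) := (isClosed_Iic.preimage hcont).isCompact
  obtain ⟨y, hy, hymax⟩ := hclosed.exists_isGreatest ⟨y₀, hy₀.le⟩
  have hS : F ⁻¹' Set.Iic t = Set.Iic y :=
    Set.Subset.antisymm (fun z hz => hymax hz) (fun z hz => (hmono hz).trans hy)
  have hFy : F y = t := le_antisymm hy (hy₀ ▸ hmono (hymax hy₀.le))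
  rw [hS, ← hFy, hF, ofReal_measureReal]

/-- Normalized positive pairwise disjoint functions whose supports cover the unit interval. -/
structure GoodTuple {r : ℝ≥0∞} [Fact (1 ≤ r)] {J : Type*} (g : J → Lp ℝ r (volume : Measure I)) :
    Prop where
  nonneg : ∀ j, 0 ≤ g j
  disjoint : Pairwise fun i j => g i ⊓ g j = 0
  norm_eq : ∀ j, ‖g j‖ = 1
  supp : ∀ᵐ y, ∃ j, g j y ≠ 0

section Distribution

variable {r : ℝ≥0∞}

/-- The measure with density `|g|^r`. -/
noncomputable def powMeasure (r : ℝ≥0∞) {α : Type*} [MeasurableSpace α] (μ : Measure α)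
    (g : α → ℝ) : Measure α :=
  μ.withDensity fun y => ‖g y‖ₑ ^ r.toReal

/-- The distribution function of the measure with density `|g|^r`. -/
noncomputable def powDistribution (g : Lp ℝ r (volume : Measure I)) (y : I) : I :=
  -- The projection changes nothing when `‖g‖ = 1`. Writing the value through a restricted norm
  -- makes continuity in `g` a matter of the triangle inequality.
  Set.projIcc 0 1 zero_le_one ((eLpNorm g r (volume.restrict (Set.Iic y))).toReal ^ r.toReal)

variable [Fact (1 ≤ r)]

theorem eLpNorm_rpow_eq_lintegral (hr : r ≠ ∞) {α V : Type*} [MeasurableSpace α]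
    [NormedAddCommGroup V] (μ : Measure α) (g : α → V) :
    eLpNorm g r μ ^ r.toReal = ∫⁻ y, ‖g y‖ₑ ^ r.toReal ∂μ := by
  have hr0 := toReal_pos_of_fact (p := r) hr
  rw [eLpNorm_eq_lintegral_rpow_enorm_toReal (zero_lt_one.trans_le Fact.out).ne' hr,
    ← ENNReal.rpow_mul, one_div, inv_mul_cancel₀ hr0.ne', ENNReal.rpow_one]

theorem powMeasure_apply (hr : r ≠ ∞) {α : Type*} [MeasurableSpace α] (μ : Measure α)
    (g : α → ℝ) {s : Set α} (hs : MeasurableSet s) :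
    powMeasure r μ g s = eLpNorm g r (μ.restrict s) ^ r.toReal := by
  rw [powMeasure, withDensity_apply _ hs, eLpNorm_rpow_eq_lintegral hr]

theorem isProbabilityMeasure_powMeasure (hr : r ≠ ∞) {g : Lp ℝ r (volume : Measure I)}
    (hg : ‖g‖ = 1) : IsProbabilityMeasure (powMeasure r volume g) := by
  constructor
  rw [powMeasure_apply hr _ _ MeasurableSet.univ, Measure.restrict_univ, ← Lp.enorm_def,
    ← ofReal_norm, hg]
  simp

theorem powDistribution_coe (hr : r ≠ ∞) {g : Lp ℝ r (volume : Measure I)} (hg : ‖g‖ = 1)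
    (y : I) : (powDistribution g y : ℝ) = (powMeasure r volume g).real (Set.Iic y) := by
  have := isProbabilityMeasure_powMeasure hr hg
  have h : (eLpNorm g r (volume.restrict (Set.Iic y))).toReal ^ r.toReal =
      (powMeasure r volume g).real (Set.Iic y) := by
    rw [measureReal_def, powMeasure_apply hr _ _ measurableSet_Iic, ENNReal.toReal_rpow]
  rw [powDistribution, h, Set.projIcc_of_mem zero_le_one
    ⟨measureReal_nonneg, measureReal_le_one⟩]

theorem measurePreserving_powDistribution (hr : r ≠ ∞) {g : Lp ℝ r (volume : Measure I)}
    (hg : ‖g‖ = 1) : Monotone (powDistribution g) ∧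
      MeasurePreserving (powDistribution g) (powMeasure r volume g) volume := by
  have := isProbabilityMeasure_powMeasure hr hg
  have : NullSingletonClass (powMeasure r (volume : Measure I) g) :=
    ⟨fun x => withDensity_absolutelyContinuous _ _ (measure_singleton x)⟩
  exact measurePreserving_distribution _ (powDistribution_coe hr hg)

theorem ae_powMeasure_iff (hr : r ≠ ∞) {α : Type*} [MeasurableSpace α] {μ : Measure α} {g : α → ℝ}
    (hg : Measurable g) {P : α → Prop} :
    (∀ᵐ y ∂powMeasure r μ g, P y) ↔ ∀ᵐ y ∂μ, g y ≠ 0 → P y := by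
  rw [powMeasure, ae_withDensity_iff (by fun_prop)]
  simp [ENNReal.rpow_eq_zero_iff, toReal_pos_of_fact (p := r) hr, not_lt.mpr ENNReal.toReal_nonneg]

/-- A good tuple `g` induces an almost everywhere isomorphism of the unit interval with `J` copies
of it, which transports the measures with densities `g j ^ r` to the Lebesgue measures on the
copies. -/
theorem GoodTuple.exists_transport (hr : r ≠ ∞) {J : Type*} [Fintype J] [MeasurableSpace J]
    [DiscreteMeasurableSpace J] {g : J → Lp ℝ r (volume : Measure I)} (hg : GoodTuple g) :
    ∃ (F : I → J × I) (K : J × I → I) (G : I → ℝ), Measurable F ∧ Measurable K ∧ Measurable G ∧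
      (∀ᵐ y, 0 < G y) ∧
      MeasurePreserving F (powMeasure r volume G) (Measure.count.prod volume) ∧
      (∀ᵐ y, K (F y) = y) ∧
      (∀ᵐ y, g (F y).1 y = G y ∧ ∀ j, j ≠ (F y).1 → g j y = 0) ∧
      ∀ᵐ y, (F y).2 = powDistribution (g (F y).1) y := by
  classical
  have hr0 := toReal_pos_of_fact (p := r) hr
  obtain ⟨y₁, j₁, -⟩ := hg.supp.exists
  have : Nonempty J := ⟨j₁⟩
  have hm : ∀ j, Measurable (g j) := fun j => (Lp.stronglyMeasurable (g j)).measurable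
  have hmF : ∀ j, Measurable (powDistribution (g j)) := fun j =>
    (measurePreserving_powDistribution hr (hg.norm_eq j)).1.measurable
  -- `T j` is the set where `g j` is positive and all other members vanish; these sets are disjoint
  -- and cover almost everything.
  set T : J → Set I := fun j => {y | 0 < g j y} ∩ ⋂ i, {y | i ≠ j → g i y = 0} with hT
  have hTm : ∀ j, MeasurableSet (T j) := by
    intro j
    refine (measurableSet_lt measurable_const (hm j)).inter (MeasurableSet.iInter fun i => ?_)
    by_cases h : i = j
    · simp [h]
    · simpa [h] using measurableSet_eq_fun (hm i) measurable_const
  have hTiff : ∀ j y, y ∈ T j ↔ 0 < g j y ∧ ∀ i, i ≠ j → g i y = 0 := by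
    intro j y
    simp [hT]
  have hTdisj : ∀ i j y, y ∈ T i → y ∈ T j → i = j := by
    intro i j y hi hj
    by_contra h
    rw [hTiff] at hi hj
    exact hi.1.ne' (hj.2 i h)
  have hcov : ∀ᵐ y, ∃ j, y ∈ T j := by
    have h1 : ∀ᵐ y, ∀ j, 0 ≤ g j y :=
      ae_all_iff.mpr fun j => (Lp.coeFn_nonneg _).mpr (hg.nonneg j)
    have h2 : ∀ᵐ y, ∀ i j, i ≠ j → g i y ⊓ g j y = 0 := by
      rw [ae_all_iff]; intro i
      rw [ae_all_iff]; intro j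
      by_cases h : i = j
      · simp [h]
      · filter_upwards [Lp_disjoint_ae (hg.disjoint h)] with y hy _ using hy
    filter_upwards [h1, h2, hg.supp] with y h1 h2 ⟨j, hj⟩
    have hj' := lt_of_le_of_ne (h1 j) hj.symm
    refine ⟨j, (hTiff _ _).mpr ⟨hj', fun i hi => ?_⟩⟩
    have := h2 i j hi
    rcases le_total (g i y) (g j y) with h | h
    · rwa [inf_eq_left.mpr h] at this
    · rw [inf_eq_right.mpr h] at this
      exact absurd this hj
  obtain ⟨F, hFm, hF⟩ := exists_measurable_piecewise T hTm
    (fun j y => (j, powDistribution (g j) y)) (fun j => measurable_const.prodMk (hmF j))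
    (fun i j hij y hy => absurd (hTdisj i j y hy.1 hy.2) hij)
  set G : I → ℝ := fun y => ∑ j, g j y with hG
  have hGm : Measurable G := Finset.measurable_sum _ fun j _ => hm j
  have hGT : ∀ j y, y ∈ T j → G y = g j y := by
    intro j y hy
    rw [hTiff] at hy
    exact Finset.sum_eq_single j (fun i _ hi => hy.2 i hi) (by simp)
  have hFT : ∀ j y, y ∈ T j → (F y).1 = j ∧ (F y).2 = powDistribution (g j) y := by
    intro j y hy
    rw [hF j hy]
    exact ⟨rfl, rfl⟩
  have hpres : MeasurePreserving F (powMeasure r volume G) (Measure.count.prod volume) := by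
    refine ⟨hFm, Measure.ext fun A hA => ?_⟩
    rw [Measure.map_apply hFm hA, Measure.prod_apply hA, lintegral_count, tsum_fintype,
      powMeasure, withDensity_apply _ (hFm hA)]
    have h1 : ∫⁻ y in F ⁻¹' A, ‖G y‖ₑ ^ r.toReal =
        ∫⁻ y in F ⁻¹' A, ∑ j, ‖g j y‖ₑ ^ r.toReal := by
      apply lintegral_congr_ae
      filter_upwards [ae_restrict_of_ae hcov] with y ⟨j, hj⟩
      rw [hGT j y hj, Finset.sum_eq_single j _ fun h => absurd (Finset.mem_univ _) h]
      intro i _ hi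
      rw [((hTiff _ _).mp hj).2 i hi]
      simp [hr0]
    rw [h1, lintegral_finsetSum _ fun j _ => by have := hm j; fun_prop]
    refine Finset.sum_congr rfl fun j _ => ?_
    rw [← withDensity_apply _ (hFm hA),
      ← (measurePreserving_powDistribution hr (hg.norm_eq j)).2.measure_preimage
        (measurable_prodMk_left hA).nullMeasurableSet]
    apply measure_congr
    have h2 : ∀ᵐ y ∂powMeasure r volume (g j), y ∈ T j := by
      rw [ae_powMeasure_iff hr (hm j)]
      filter_upwards [hcov] with y ⟨i, hi⟩ h
      by_cases hij : j = i
      · rwa [hij]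
      · exact absurd (((hTiff _ _).mp hi).2 j hij) h
    filter_upwards [h2] with y hy
    apply propext
    change F y ∈ A ↔ (j, powDistribution (g j) y) ∈ A
    rw [hF j hy]
  obtain ⟨D, hDc, hDd⟩ := TopologicalSpace.exists_countable_dense I
  -- `F` fails to be injective on `T j` only along flat stretches of the distribution function. Each
  -- nondegenerate one contains a point of the countable dense set `D`, so `N` collects them; it is
  -- null because points have Lebesgue measure zero and `g j` is positive on `T j`.
  set N : Set I := ⋃ j, ⋃ b ∈ D, powDistribution (g j) ⁻¹' {powDistribution (g j) b} ∩ T j with hN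
  have hNm : MeasurableSet N := MeasurableSet.iUnion fun j => MeasurableSet.biUnion hDc fun b _ =>
    (hmF j (measurableSet_singleton _)).inter (hTm j)
  have hN0 : volume N = 0 := by
    rw [hN, measure_iUnion_null_iff]
    intro j
    rw [measure_biUnion_null_iff hDc]
    intro b _
    have h1 : powMeasure r volume (g j)
        (powDistribution (g j) ⁻¹' {powDistribution (g j) b}) = 0 := by
      rw [(measurePreserving_powDistribution hr (hg.norm_eq j)).2.measure_preimage
        (measurableSet_singleton _).nullMeasurableSet, measure_singleton]
    have h2 : ∀ᵐ y ∂powMeasure r volume (g j),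
        y ∉ powDistribution (g j) ⁻¹' {powDistribution (g j) b} := measure_eq_zero_iff_ae_notMem.mp h1
    rw [ae_powMeasure_iff hr (hm j)] at h2
    rw [measure_eq_zero_iff_ae_notMem]
    filter_upwards [h2] with y hy hyT
    exact hy ((hTiff _ _).mp hyT.2).1.ne' hyT.1
  set S : Set I := (⋃ j, T j) \ N with hS
  have hSm : MeasurableSet S := (MeasurableSet.iUnion hTm).diff hNm
  have hinj : Set.InjOn F S := by
    have key : ∀ x ∈ S, ∀ y ∈ S, F x = F y → ¬ x < y := by
      intro x hx y hy hxy hlt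
      obtain ⟨i, hi⟩ := Set.mem_iUnion.mp hx.1
      obtain ⟨j, hj⟩ := Set.mem_iUnion.mp hy.1
      rw [hF i hi, hF j hj, Prod.mk.injEq] at hxy
      obtain ⟨rfl, h⟩ := hxy
      obtain ⟨b, hbD, hxb, hby⟩ := hDd.exists_between hlt
      have hmono := (measurePreserving_powDistribution hr (hg.norm_eq i)).1
      refine hx.2 (Set.mem_iUnion.mpr ⟨i, Set.mem_biUnion hbD ⟨?_, hi⟩⟩)
      exact le_antisymm (hmono hxb.le) (h ▸ hmono hby.le)
    intro x hx y hy hxy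
    rcases lt_trichotomy x y with h | h | h
    · exact absurd h (key x hx y hy hxy)
    · exact h
    · exact absurd h (key y hy x hx hxy.symm)
  have hSae : ∀ᵐ y, y ∈ S := by
    filter_upwards [hcov, measure_eq_zero_iff_ae_notMem.mp hN0] with y ⟨j, hj⟩ h2
    exact ⟨Set.mem_iUnion.mpr ⟨j, hj⟩, h2⟩
  have : StandardBorelSpace S := hSm.standardBorel
  -- Lusin–Souslin: an injective measurable map on a standard Borel space is a measurable embedding,
  -- so its inverse extends to a measurable `K`.
  have hemb : MeasurableEmbedding (S.domRestrict F) :=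
    (hFm.comp measurable_subtype_coe).measurableEmbedding (Set.injOn_iff_injective.mp hinj)
  obtain ⟨K, hKm, hK⟩ := hemb.exists_measurable_extend measurable_subtype_coe
    (fun _ => ⟨(0 : I)⟩)
  refine ⟨F, K, G, hFm, hKm, hGm, ?_, hpres, ?_, ?_, ?_⟩
  · filter_upwards [hcov] with y ⟨j, hj⟩
    rw [hGT j y hj]
    exact ((hTiff _ _).mp hj).1
  · filter_upwards [hSae] with y hy
    exact congrFun hK ⟨y, hy⟩
  · filter_upwards [hcov] with y ⟨j, hj⟩
    rw [(hFT j y hj).1, hGT j y hj]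
    exact ⟨rfl, ((hTiff _ _).mp hj).2⟩
  · filter_upwards [hcov] with y ⟨j, hj⟩
    rw [(hFT j y hj).1, (hFT j y hj).2]

end Distribution

instance Lp_isOrderedModule {α V : Type*} [MeasurableSpace α] {μ : Measure α} {p : ℝ≥0∞}
    [NormedAddCommGroup V] [NormedSpace ℝ V] [Lattice V] [HasSolidNorm V] [IsOrderedAddMonoid V]
    [IsOrderedModule ℝ V] : IsOrderedModule ℝ (Lp V p μ) :=
  IsOrderedModule.of_smul_nonneg fun c hc f hf => by
    rw [← Lp.coeFn_nonneg] at hf ⊢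
    filter_upwards [Lp.coeFn_smul c f, hf] with y h1 h2
    rw [h1]
    exact smul_nonneg hc h2

/-! ### Weighted composition operators -/

section WeightedComp

variable {α β V : Type*} [MeasurableSpace α] [MeasurableSpace β] [NormedAddCommGroup V]
  [NormedSpace ℝ V] {μ : Measure α} {ν : Measure β} {p : ℝ≥0∞} [Fact (1 ≤ p)]

theorem absolutelyContinuous_powMeasure (hp : p ≠ ∞) {G : α → ℝ} (hG : Measurable G)
    (hG0 : ∀ᵐ y ∂μ, 0 < G y) : μ ≪ powMeasure p μ G := by
  refine Measure.AbsolutelyContinuous.mk fun s hs h => ?_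
  rw [measure_eq_zero_iff_ae_notMem, ae_powMeasure_iff hp hG] at h
  rw [measure_eq_zero_iff_ae_notMem]
  filter_upwards [h, hG0] with y h1 h2 using h1 h2.ne'

/-- Change of variables: `|G| ^ p` is exactly the density of the measure that `F` carries to `ν`. -/
theorem eLpNorm_smul_comp (hp : p ≠ ∞) {F : α → β} {G : α → ℝ} (hG : Measurable G)
    (hF : MeasurePreserving F (powMeasure p μ G) ν) (hG0 : ∀ᵐ y ∂μ, 0 < G y) {h : β → V}
    (hh : AEStronglyMeasurable h ν) : eLpNorm (fun y => G y • h (F y)) p μ = eLpNorm h p ν := by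
  have hp0 := toReal_pos_of_fact (p := p) hp
  have hqmp : AEStronglyMeasurable (fun y => h (F y)) μ :=
    (hh.comp_measurePreserving hF).mono_ac (absolutelyContinuous_powMeasure hp hG hG0)
  have : eLpNorm (fun y => G y • h (F y)) p μ ^ p.toReal = eLpNorm h p ν ^ p.toReal := by
    rw [← eLpNorm_comp_measurePreserving hh hF, eLpNorm_rpow_eq_lintegral hp,
      eLpNorm_rpow_eq_lintegral hp, powMeasure,
      lintegral_withDensity_eq_lintegral_mul₀ (by fun_prop) (by
        have := hqmp.enorm
        simp only [Function.comp_apply]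
        fun_prop)]
    refine lintegral_congr fun y => ?_
    simp only [enorm_smul, Pi.mul_apply, Function.comp_apply]
    rw [ENNReal.mul_rpow_of_nonneg _ _ hp0.le]
  exact ENNReal.rpow_left_injective hp0.ne' this

/-- Weighted composition with an almost everywhere isomorphism. -/
theorem exists_weightedComp (hp : p ≠ ∞) {F : α → β} {K : β → α} {G : α → ℝ}
    (hK : Measurable K) (hG : Measurable G) (hG0 : ∀ᵐ y ∂μ, 0 < G y)
    (hF : MeasurePreserving F (powMeasure p μ G) ν) (hKF : ∀ᵐ y ∂μ, K (F y) = y) :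
    ∃ U : Lp V p ν ≃ₗᵢ[ℝ] Lp V p μ, ∀ h : Lp V p ν, U h =ᵐ[μ] fun y => G y • h (F y) := by
  have hac := absolutelyContinuous_powMeasure hp hG hG0
  have hac' : powMeasure p μ G ≪ μ := withDensity_absolutelyContinuous _ _
  have hqmp : Measure.QuasiMeasurePreserving F μ ν :=
    ⟨hF.measurable, (hac.map hF.measurable).trans hF.map_eq.absolutelyContinuous⟩
  have hmem : ∀ h : Lp V p ν, MemLp (fun y => G y • h (F y)) p μ := fun h =>
    ⟨hG.aestronglyMeasurable.smul ((Lp.aestronglyMeasurable h).comp_quasiMeasurePreserving hqmp),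
      by rw [eLpNorm_smul_comp hp hG hF hG0 (Lp.aestronglyMeasurable h)]
         exact Lp.eLpNorm_lt_top h⟩
  let U₀ : Lp V p ν →ₗ[ℝ] Lp V p μ :=
    { toFun := fun h => (hmem h).toLp _
      map_add' := by
        intro h k
        apply Lp.ext
        filter_upwards [(hmem (h + k)).coeFn_toLp, (hmem h).coeFn_toLp, (hmem k).coeFn_toLp,
          Lp.coeFn_add ((hmem h).toLp _) ((hmem k).toLp _), hqmp.ae (Lp.coeFn_add h k)]
          with y h1 h2 h3 h4 h5
        rw [h1, h4, Pi.add_apply, h2, h3, h5, Pi.add_apply, smul_add]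
      map_smul' := by
        intro c h
        apply Lp.ext
        filter_upwards [(hmem (c • h)).coeFn_toLp, (hmem h).coeFn_toLp,
          Lp.coeFn_smul c ((hmem h).toLp _), hqmp.ae (Lp.coeFn_smul c h)] with y h1 h2 h4 h5
        rw [h1, RingHom.id_apply, h4, Pi.smul_apply, h2, h5, Pi.smul_apply, smul_comm] }
  have hU₀ : ∀ h, U₀ h =ᵐ[μ] fun y => G y • h (F y) := fun h => (hmem h).coeFn_toLp
  let U₁ : Lp V p ν →ₗᵢ[ℝ] Lp V p μ :=
    { U₀ with
      norm_map' := by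
        intro h
        rw [Lp.norm_def, Lp.norm_def, eLpNorm_congr_ae (hU₀ h),
          eLpNorm_smul_comp hp hG hF hG0 (Lp.aestronglyMeasurable h)] }
  have hU₁ : ∀ h, U₁ h =ᵐ[μ] fun y => G y • h (F y) := hU₀
  -- Since `K ∘ F` is almost everywhere the identity, `K` reverses the transport; composition with
  -- `K` therefore respects null sets and supplies the preimages for surjectivity.
  have hKpres : MeasurePreserving K ν (powMeasure p μ G) := by
    refine ⟨hK, ?_⟩
    rw [← hF.map_eq, Measure.map_map hK hF.measurable]
    have : K ∘ F =ᵐ[powMeasure p μ G] id := hac'.ae_le hKF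
    rw [Measure.map_congr this, Measure.map_id]
  have hqK : Measure.QuasiMeasurePreserving K ν μ :=
    ⟨hK, hKpres.map_eq.absolutelyContinuous.trans hac'⟩
  have hsurj : Function.Surjective U₁ := by
    intro w
    set h : β → V := fun z => (G (K z))⁻¹ • w (K z) with hh
    have hmh : AEStronglyMeasurable h ν :=
      ((hG.comp hK).inv.aestronglyMeasurable).smul
        ((Lp.aestronglyMeasurable w).comp_quasiMeasurePreserving hqK)
    have hwe : (fun y => G y • h (F y)) =ᵐ[μ] w := by
      filter_upwards [hKF, hG0] with y h1 h2
      rw [hh]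
      simp only
      rw [h1, smul_smul, mul_inv_cancel₀ h2.ne', one_smul]
    have hhm : MemLp h p ν := ⟨hmh, by
      rw [← eLpNorm_smul_comp hp hG hF hG0 hmh, eLpNorm_congr_ae hwe]
      exact Lp.eLpNorm_lt_top w⟩
    refine ⟨hhm.toLp h, Lp.ext ?_⟩
    filter_upwards [hU₁ (hhm.toLp h), hwe, hqmp.ae hhm.coeFn_toLp] with y h1 h2 h3
    rw [h1, h3, h2]
  exact ⟨LinearIsometryEquiv.ofSurjective U₁ hsurj, hU₁⟩

theorem smul_sup_of_pos [Lattice V] [IsOrderedModule ℝ V] {c : ℝ} (hc : 0 < c) (x y : V) :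
    c • (x ⊔ y) = c • x ⊔ c • y := by
  refine le_antisymm ?_ (sup_le (smul_le_smul_of_nonneg_left le_sup_left hc.le)
    (smul_le_smul_of_nonneg_left le_sup_right hc.le))
  rw [← le_inv_smul_iff_of_pos hc]
  exact sup_le ((le_inv_smul_iff_of_pos hc).mpr le_sup_left)
    ((le_inv_smul_iff_of_pos hc).mpr le_sup_right)

theorem smul_inf_of_pos [Lattice V] [IsOrderedModule ℝ V] {c : ℝ} (hc : 0 < c) (x y : V) :
    c • (x ⊓ y) = c • x ⊓ c • y := by
  refine le_antisymm (le_inf (smul_le_smul_of_nonneg_left inf_le_left hc.le)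
    (smul_le_smul_of_nonneg_left inf_le_right hc.le)) ?_
  rw [← inv_smul_le_iff_of_pos hc]
  exact le_inf ((inv_smul_le_iff_of_pos hc).mpr inf_le_left)
    ((inv_smul_le_iff_of_pos hc).mpr inf_le_right)

theorem preservesLattice_of_ae_smul [Lattice V] [HasSolidNorm V] [IsOrderedAddMonoid V]
    [IsOrderedModule ℝ V] {F : α → β} {G : α → ℝ} (hG0 : ∀ᵐ y ∂μ, 0 < G y)
    (hF : Measure.QuasiMeasurePreserving F μ ν) {U : Lp V p ν → Lp V p μ}
    (hU : ∀ h : Lp V p ν, U h =ᵐ[μ] fun y => G y • h (F y)) : PreservesLattice U := by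
  constructor
  · intro h k
    apply Lp.ext
    filter_upwards [hU (h ⊔ k), hU h, hU k, Lp.coeFn_sup (U h) (U k), hF.ae (Lp.coeFn_sup h k), hG0]
      with y h1 h2 h3 h4 h5 h6
    rw [h1, h4, Pi.sup_apply, h2, h3, h5, Pi.sup_apply, smul_sup_of_pos h6]
  · intro h k
    apply Lp.ext
    filter_upwards [hU (h ⊓ k), hU h, hU k, Lp.coeFn_inf (U h) (U k), hF.ae (Lp.coeFn_inf h k), hG0]
      with y h1 h2 h3 h4 h5 h6
    rw [h1, h4, Pi.inf_apply, h2, h3, h5, Pi.inf_apply, smul_inf_of_pos h6]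

theorem PreservesLattice.comp {X Y Z : Type*} [Lattice X] [Lattice Y] [Lattice Z] {f : Y → Z}
    {g : X → Y} (hf : PreservesLattice f) (hg : PreservesLattice g) :
    PreservesLattice fun x => f (g x) :=
  ⟨fun x y => by rw [hg.map_sup, hf.map_sup], fun x y => by rw [hg.map_inf, hf.map_inf]⟩

theorem PreservesLattice.symm {X Y : Type*} [NormedAddCommGroup X] [NormedSpace ℝ X] [Lattice X]
    [NormedAddCommGroup Y] [NormedSpace ℝ Y] [Lattice Y] {f : X ≃ₗᵢ[ℝ] Y}
    (hf : PreservesLattice f) : PreservesLattice f.symm := by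
  constructor
  · intro x y
    apply f.injective
    rw [hf.map_sup]
    simp
  · intro x y
    apply f.injective
    rw [hf.map_inf]
    simp

end WeightedComp

/-! ### Measurable families of isometries -/

section OperatorFamily

variable {Z : Type*} [MeasurableSpace Z]

/-- In a second countable space every open set is a countable union of balls, and the hypothesis
makes preimages of balls measurable. -/
theorem stronglyMeasurable_of_dist {V : Type*} [PseudoMetricSpace V] [SecondCountableTopology V]
    {f : Z → V} (h : ∀ v, Measurable fun z => dist (f z) v) : StronglyMeasurable f := by
  borelize V
  refine Measurable.stronglyMeasurable (measurable_of_isOpen fun s hs => ?_)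
  choose ε hε hball using fun x : s => Metric.isOpen_iff.mp hs x x.2
  obtain ⟨T, hTc, hT⟩ := TopologicalSpace.isOpen_iUnion_countable
    (fun x : s => Metric.ball (x : V) (ε x)) fun x => Metric.isOpen_ball
  have hs' : s = ⋃ x ∈ T, Metric.ball (x : V) (ε x) := by
    rw [hT]
    refine Set.Subset.antisymm (fun x hx => Set.mem_iUnion.mpr ⟨⟨x, hx⟩, ?_⟩)
      (Set.iUnion_subset hball)
    exact Metric.mem_ball_self (hε _)
  rw [hs', Set.preimage_iUnion₂]
  exact MeasurableSet.biUnion hTc fun x _ => measurableSet_lt (h x) measurable_const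

variable {V V' : Type*} [NormedAddCommGroup V] [NormedSpace ℝ V] [SecondCountableTopology V]
  [NormedAddCommGroup V'] [NormedSpace ℝ V'] [SecondCountableTopology V']

/-- Distances suffice: the isometry property turns the distance from `(W z).symm w` to `v` into that
from `w` to `W z v`. -/
theorem stronglyMeasurable_symm_apply {W : Z → V ≃ₗᵢ[ℝ] V'}
    (hW : ∀ v, StronglyMeasurable fun z => W z v) (w : V') :
    StronglyMeasurable fun z => (W z).symm w := by
  refine stronglyMeasurable_of_dist fun v => ?_
  have : (fun z => dist ((W z).symm w) v) = fun z => dist w (W z v) := by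
    funext z
    rw [← (W z).dist_map, (W z).apply_symm_apply]
  rw [this]
  exact (stronglyMeasurable_const.dist (hW v)).measurable

/-- `(v, z) ↦ W z v` is continuous in `v` and measurable in `z`, hence jointly measurable. -/
theorem StronglyMeasurable.operator_apply {W : Z → V ≃ₗᵢ[ℝ] V'}
    (hW : ∀ v, StronglyMeasurable fun z => W z v) {k : Z → V} (hk : StronglyMeasurable k) :
    StronglyMeasurable fun z => W z (k z) := by
  borelize V
  have h := stronglyMeasurable_uncurry_of_continuous_of_stronglyMeasurable
    (u := fun (v : V) (z : Z) => W z v) (fun z => (W z).continuous) hW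
  exact h.comp_measurable (hk.measurable.prodMk measurable_id)

theorem AEStronglyMeasurable.operator_apply {ρ : Measure Z} {W : Z → V ≃ₗᵢ[ℝ] V'}
    (hW : ∀ v, StronglyMeasurable fun z => W z v) {k : Z → V} (hk : AEStronglyMeasurable k ρ) :
    AEStronglyMeasurable (fun z => W z (k z)) ρ := by
  refine ⟨_, StronglyMeasurable.operator_apply hW hk.stronglyMeasurable_mk, ?_⟩
  filter_upwards [hk.ae_eq_mk] with z hz
  rw [← hz]

/-- A strongly measurable family of surjective isometries acts fibrewise on a Bochner space. -/
theorem exists_fibrewise {ρ : Measure Z} {p : ℝ≥0∞} [Fact (1 ≤ p)] {W : Z → V ≃ₗᵢ[ℝ] V'}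
    (hW : ∀ v, StronglyMeasurable fun z => W z v) :
    ∃ T : Lp V p ρ ≃ₗᵢ[ℝ] Lp V' p ρ, ∀ h : Lp V p ρ, T h =ᵐ[ρ] fun z => W z (h z) := by
  have hmem : ∀ h : Lp V p ρ, MemLp (fun z => W z (h z)) p ρ := fun h =>
    (Lp.memLp h).of_le (AEStronglyMeasurable.operator_apply hW (Lp.aestronglyMeasurable h))
      (Filter.Eventually.of_forall fun z => ((W z).norm_map _).le)
  let T₀ : Lp V p ρ →ₗ[ℝ] Lp V' p ρ :=
    { toFun := fun h => (hmem h).toLp _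
      map_add' := by
        intro h k
        apply Lp.ext
        filter_upwards [(hmem (h + k)).coeFn_toLp, (hmem h).coeFn_toLp, (hmem k).coeFn_toLp,
          Lp.coeFn_add ((hmem h).toLp _) ((hmem k).toLp _), Lp.coeFn_add h k] with y h1 h2 h3 h4 h5
        rw [h1, h4, Pi.add_apply, h2, h3, h5, Pi.add_apply, map_add]
      map_smul' := by
        intro c h
        apply Lp.ext
        filter_upwards [(hmem (c • h)).coeFn_toLp, (hmem h).coeFn_toLp,
          Lp.coeFn_smul c ((hmem h).toLp _), Lp.coeFn_smul c h] with y h1 h2 h4 h5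
        rw [h1, RingHom.id_apply, h4, Pi.smul_apply, h2, h5, Pi.smul_apply, map_smul] }
  have hT₀ : ∀ h, T₀ h =ᵐ[ρ] fun z => W z (h z) := fun h => (hmem h).coeFn_toLp
  let T₁ : Lp V p ρ →ₗᵢ[ℝ] Lp V' p ρ :=
    { T₀ with
      norm_map' := by
        intro h
        rw [Lp.norm_def, Lp.norm_def, eLpNorm_congr_ae (hT₀ h)]
        congr 1
        exact eLpNorm_congr_norm_ae (Filter.Eventually.of_forall fun z => (W z).norm_map _) }
  refine ⟨LinearIsometryEquiv.ofSurjective T₁ fun w => ?_, hT₀⟩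
  have hw : MemLp (fun z => (W z).symm (w z)) p ρ :=
    (Lp.memLp w).of_le (AEStronglyMeasurable.operator_apply (W := fun z => (W z).symm)
      (stronglyMeasurable_symm_apply hW) (Lp.aestronglyMeasurable w))
      (Filter.Eventually.of_forall fun z => ((W z).symm.norm_map _).le)
  refine ⟨hw.toLp _, Lp.ext ?_⟩
  filter_upwards [hT₀ (hw.toLp _), hw.coeFn_toLp] with z h1 h2
  refine h1.trans ?_
  rw [h2, (W z).apply_symm_apply]

theorem preservesLattice_of_fibrewise [Lattice V] [HasSolidNorm V] [IsOrderedAddMonoid V]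
    [Lattice V'] [HasSolidNorm V'] [IsOrderedAddMonoid V'] {ρ : Measure Z} {p : ℝ≥0∞}
    {W : Z → V ≃ₗᵢ[ℝ] V'} (hW : ∀ z, PreservesLattice (W z)) {T : Lp V p ρ → Lp V' p ρ}
    (hT : ∀ h : Lp V p ρ, T h =ᵐ[ρ] fun z => W z (h z)) : PreservesLattice T := by
  constructor
  · intro h k
    apply Lp.ext
    filter_upwards [hT (h ⊔ k), hT h, hT k, Lp.coeFn_sup (T h) (T k), Lp.coeFn_sup h k]
      with y h1 h2 h3 h4 h5
    rw [h1, h4, Pi.sup_apply, h2, h3, h5, Pi.sup_apply, (hW y).map_sup]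
  · intro h k
    apply Lp.ext
    filter_upwards [hT (h ⊓ k), hT h, hT k, Lp.coeFn_inf (T h) (T k), Lp.coeFn_inf h k]
      with y h1 h2 h3 h4 h5
    rw [h1, h4, Pi.inf_apply, h2, h3, h5, Pi.inf_apply, (hW y).map_inf]

end OperatorFamily

/-! ### Continuous dependence of the fibre isometry on the tuple -/

section FibreTransport

variable {q : ℝ≥0∞} [Fact (1 ≤ q)] {J : Type*} [Fintype J] [TopologicalSpace J]
  [DiscreteTopology J] [MeasurableSpace J] [DiscreteMeasurableSpace J]

/-- The indicator function of the copy of the unit interval with index `j`. -/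
noncomputable def copyIndicator (q : ℝ≥0∞) (j : J) :
    Lp ℝ q ((Measure.count : Measure J).prod (volume : Measure I)) :=
  indicatorConstLp q (s := {j} ×ˢ Set.univ) ((measurableSet_singleton j).prod MeasurableSet.univ)
    (measure_ne_top _ _) 1

/-- The formula on continuous functions, which are dense, determines `U` and exhibits its dependence
on `g`; the continuity estimates below rest on it. -/
theorem GoodTuple.exists_iso (hq : q ≠ ∞) {g : J → Lp ℝ q (volume : Measure I)}
    (hg : GoodTuple g) :
    ∃ U : Lp ℝ q ((Measure.count : Measure J).prod (volume : Measure I)) ≃ₗᵢ[ℝ]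
      Lp ℝ q (volume : Measure I), PreservesLattice U ∧ (∀ j, U (copyIndicator q j) = g j) ∧
      ∀ v : C(J × I, ℝ), U (ContinuousMap.toLp q _ ℝ v) =ᵐ[volume]
        fun y => ∑ j, g j y * v (j, powDistribution (g j) y) := by
  obtain ⟨F, K, G, hF, hK, hG, hG0, hpres, hKF, hgF, hdist⟩ := hg.exists_transport hq
  have hqmp : Measure.QuasiMeasurePreserving F volume (Measure.count.prod volume) :=
    ⟨hF, ((absolutelyContinuous_powMeasure hq hG hG0).map hF).trans
      hpres.map_eq.absolutelyContinuous⟩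
  obtain ⟨U, hU⟩ := exists_weightedComp (V := ℝ) hq hK hG hG0 hpres hKF
  refine ⟨U, preservesLattice_of_ae_smul hG0 hqmp hU, fun j => ?_, fun v => ?_⟩
  · apply Lp.ext
    filter_upwards [hU (copyIndicator q j), hgF, hqmp.ae (indicatorConstLp_coeFn (p := q)
      (s := {j} ×ˢ Set.univ) (hs := (measurableSet_singleton j).prod MeasurableSet.univ)
      (hμs := measure_ne_top ((Measure.count : Measure J).prod (volume : Measure I)) _)
      (c := (1 : ℝ)))] with y h1 h2 h3
    rw [h1, copyIndicator, h3]
    by_cases h : (F y).1 = j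
    · rw [Set.indicator_of_mem (by simp [h]), ← h, h2.1]
      simp
    · rw [Set.indicator_of_notMem (by simp [h]), h2.2 j (Ne.symm h)]
      simp
  · filter_upwards [hU (ContinuousMap.toLp q _ ℝ v), hgF, hdist,
      hqmp.ae (ContinuousMap.coeFn_toLp (p := q) (𝕜 := ℝ) (Measure.count.prod volume) v)]
      with y h1 h2 h3 h4
    rw [h1, h4, Finset.sum_eq_single (F y).1 (fun j _ hj => by rw [h2.2 j hj, zero_mul])
      (fun h => absurd (Finset.mem_univ _) h), h2.1, ← h3, smul_eq_mul]

/-- The isomorphism of `L_q` of `J` copies of the unit interval with `L_q[0,1]` determined by a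
good tuple. -/
noncomputable def GoodTuple.iso (hq : q ≠ ∞) {g : J → Lp ℝ q (volume : Measure I)}
    (hg : GoodTuple g) : Lp ℝ q ((Measure.count : Measure J).prod (volume : Measure I)) ≃ₗᵢ[ℝ]
      Lp ℝ q (volume : Measure I) :=
  (hg.exists_iso hq).choose

/-- Reverse triangle inequality for the restricted norm; the bound does not depend on `s`. -/
theorem abs_toReal_eLpNorm_restrict_sub_le (g g' : Lp ℝ q (volume : Measure I)) (s : Set I) :
    |(eLpNorm g q (volume.restrict s)).toReal - (eLpNorm g' q (volume.restrict s)).toReal| ≤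
      ‖g - g'‖ := by
  have hm : ∀ f : Lp ℝ q (volume : Measure I), MemLp f q (volume.restrict s) := fun f =>
    (Lp.memLp f).mono_measure Measure.restrict_le_self
  have key : ∀ f f' : Lp ℝ q (volume : Measure I), (eLpNorm f q (volume.restrict s)).toReal ≤
      (eLpNorm f' q (volume.restrict s)).toReal + ‖f - f'‖ := by
    intro f f'
    rw [Lp.norm_def, ← ENNReal.toReal_add (hm f').2.ne (Lp.eLpNorm_ne_top _)]
    refine ENNReal.toReal_mono (ENNReal.add_ne_top.mpr ⟨(hm f').2.ne, Lp.eLpNorm_ne_top _⟩) ?_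
    calc eLpNorm f q (volume.restrict s)
        = eLpNorm (f' + (f - f' : Lp ℝ q (volume : Measure I)) : I → ℝ) q (volume.restrict s) := by
          apply eLpNorm_congr_ae
          filter_upwards [ae_restrict_of_ae (Lp.coeFn_sub f f')] with y hy
          rw [Pi.add_apply, hy, Pi.sub_apply, add_sub_cancel]
      _ ≤ _ := eLpNorm_add_le (hm _).1 (hm _).1 Fact.out
      _ ≤ _ := add_le_add le_rfl (eLpNorm_mono_measure (f - f' : Lp ℝ q (volume : Measure I))
          Measure.restrict_le_self)
  rw [abs_sub_le_iff]
  have h1 := key g g'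
  have h2 := key g' g
  rw [norm_sub_rev] at h2
  constructor <;> linarith

/-- `v (j, powDistribution g y)` is a continuous function on the compact interval evaluated at the
norm of `g` restricted to `Iic y`. That norm is 1-Lipschitz in `g`, so one `δ` serves all `y`. -/
theorem powDistribution_uniformly_continuous (hq : q ≠ ∞) (v : C(J × I, ℝ)) {ε : ℝ}
    (hε : 0 < ε) : ∃ δ > 0, ∀ g g' : Lp ℝ q (volume : Measure I), ‖g‖ = 1 → ‖g'‖ = 1 →
      ‖g - g'‖ < δ → ∀ (j : J) (y : I),
        |v (j, powDistribution g y) - v (j, powDistribution g' y)| ≤ ε := by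
  have hq0 := toReal_pos_of_fact (p := q) hq
  let w : J × I → ℝ := fun x => v (x.1, Set.projIcc 0 1 zero_le_one ((x.2 : ℝ) ^ q.toReal))
  have hw : Continuous w := by
    refine v.continuous.comp (continuous_fst.prodMk (continuous_projIcc.comp ?_))
    exact (continuous_subtype_val.comp continuous_snd).rpow_const fun _ => Or.inr hq0.le
  let w' : J → I → ℝ := fun j b => w (j, b)
  have hw' : ∀ j, UniformContinuous (w' j) := fun j =>
    CompactSpace.uniformContinuous_of_continuous (hw.comp (Continuous.prodMk_right j))
  choose δ hδ0 hδ using fun j => Metric.uniformContinuous_iff.mp (hw' j) ε hε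
  obtain ⟨d, hd0, hd⟩ : ∃ d > 0, ∀ j, d ≤ δ j := by
    rcases isEmpty_or_nonempty J with h | h
    · exact ⟨1, one_pos, fun j => (h.false j).elim⟩
    · obtain ⟨j, hj⟩ := Finite.exists_min δ
      exact ⟨δ j, hδ0 j, hj⟩
  refine ⟨d, hd0, fun g g' hg hg' hgg j y => ?_⟩
  let b : Lp ℝ q (volume : Measure I) → ℝ := fun f =>
    (eLpNorm f q (volume.restrict (Set.Iic y))).toReal
  have hb : ∀ f : Lp ℝ q (volume : Measure I), ‖f‖ = 1 → b f ∈ Set.Icc (0 : ℝ) 1 := by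
    intro f hf
    refine ⟨ENNReal.toReal_nonneg, ?_⟩
    rw [← hf, Lp.norm_def]
    exact ENNReal.toReal_mono (Lp.eLpNorm_ne_top _)
      (eLpNorm_mono_measure _ Measure.restrict_le_self)
  have hv : ∀ f : Lp ℝ q (volume : Measure I), (hf : ‖f‖ = 1) →
      v (j, powDistribution f y) = w' j ⟨b f, hb f hf⟩ := fun f hf => rfl
  rw [hv g hg, hv g' hg', ← Real.dist_eq]
  refine (hδ j ?_).le
  refine lt_of_lt_of_le ?_ (hd j)
  refine lt_of_le_of_lt ?_ hgg
  rw [Subtype.dist_eq, Real.dist_eq]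
  exact abs_toReal_eLpNorm_restrict_sub_le g g' _

theorem GoodTuple.iso_continuousMap_close (hq : q ≠ ∞) (v : C(J × I, ℝ)) {ε : ℝ} (hε : 0 < ε) :
    ∃ δ > 0, ∀ (g g' : J → Lp ℝ q (volume : Measure I)) (hg : GoodTuple g) (hg' : GoodTuple g'),
      (∀ j, ‖g j - g' j‖ < δ) →
      ‖hg.iso hq (ContinuousMap.toLp q _ ℝ v) - hg'.iso hq (ContinuousMap.toLp q _ ℝ v)‖ ≤ ε := by
  set n : ℝ := (Fintype.card J : ℝ) with hn
  set M : ℝ := ‖v‖ with hM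
  have hn0 : 0 ≤ n := Nat.cast_nonneg _
  have hM0 : 0 ≤ M := norm_nonneg _
  -- Each of the `n` summands will cost at most `2 * η`. The shifts in `n + 1` and `M + 1` avoid
  -- division by zero when `J` is empty or `v = 0`.
  set η : ℝ := ε / (2 * (n + 1)) with hη
  have hη0 : 0 < η := by positivity
  obtain ⟨δ, hδ0, hδ⟩ := powDistribution_uniformly_continuous (J := J) hq v hη0
  refine ⟨min δ (η / (M + 1)), by positivity, fun g g' hg hg' hgg => ?_⟩
  have h1 : |hg.iso hq (ContinuousMap.toLp q _ ℝ v) - hg'.iso hq (ContinuousMap.toLp q _ ℝ v)| ≤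
      |∑ j, (M • |g j - g' j| + η • |g' j|)| := by
    have hR : 0 ≤ ∑ j, (M • |g j - g' j| + η • |g' j|) := Finset.sum_nonneg fun j _ => add_nonneg
      (smul_nonneg hM0 (abs_nonneg _)) (smul_nonneg hη0.le (abs_nonneg _))
    rw [abs_of_nonneg hR, ← Lp.coeFn_le]
    have hsum : (∑ j, (M • |g j - g' j| + η • |g' j|) : Lp ℝ q (volume : Measure I)) =ᵐ[volume]
        fun y => ∑ j, (M * |g j y - g' j y| + η * |g' j y|) := by
      have h2 := Lp.coeFn_finsetSum (Finset.univ : Finset J)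
        (fun j => (M • |g j - g' j| + η • |g' j| : Lp ℝ q (volume : Measure I)))
      have h3 : ∀ᵐ y, ∀ j, (M • |g j - g' j| + η • |g' j| : Lp ℝ q (volume : Measure I)) y =
          M * |g j y - g' j y| + η * |g' j y| := by
        rw [ae_all_iff]
        intro j
        filter_upwards [Lp.coeFn_add (M • |g j - g' j|) (η • |g' j|),
          Lp.coeFn_smul M |g j - g' j|, Lp.coeFn_smul η |g' j|, Lp.coeFn_abs (g j - g' j),
          Lp.coeFn_abs (g' j), Lp.coeFn_sub (g j) (g' j)] with y a1 a2 a3 a4 a5 a6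
        rw [a1, Pi.add_apply, a2, a3, Pi.smul_apply, Pi.smul_apply, a4, a5, a6, Pi.sub_apply,
          smul_eq_mul, smul_eq_mul]
      filter_upwards [h2, h3] with y h2 h3
      rw [h2, Finset.sum_apply]
      exact Finset.sum_congr rfl fun j _ => h3 j
    filter_upwards [hsum, (hg.exists_iso hq).choose_spec.2.2 v,
      (hg'.exists_iso hq).choose_spec.2.2 v,
      Lp.coeFn_abs (hg.iso hq (ContinuousMap.toLp q _ ℝ v) -
        hg'.iso hq (ContinuousMap.toLp q _ ℝ v)),
      Lp.coeFn_sub (hg.iso hq (ContinuousMap.toLp q _ ℝ v))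
        (hg'.iso hq (ContinuousMap.toLp q _ ℝ v))] with y a1 a2 a3 a4 a5
    rw [a1, a4, a5, Pi.sub_apply]
    change |((hg.exists_iso hq).choose _ : Lp ℝ q (volume : Measure I)) y -
      ((hg'.exists_iso hq).choose _ : Lp ℝ q (volume : Measure I)) y| ≤ _
    rw [a2, a3, ← Finset.sum_sub_distrib]
    refine (Finset.abs_sum_le_sum_abs _ _).trans (Finset.sum_le_sum fun j _ => ?_)
    have e1 : g j y * v (j, powDistribution (g j) y) - g' j y * v (j, powDistribution (g' j) y) =
        v (j, powDistribution (g j) y) * (g j y - g' j y) +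
        (v (j, powDistribution (g j) y) - v (j, powDistribution (g' j) y)) * g' j y := by ring
    rw [e1]
    refine (abs_add_le _ _).trans ?_
    rw [abs_mul, abs_mul]
    refine add_le_add (mul_le_mul_of_nonneg_right (v.norm_coe_le_norm _) (abs_nonneg _))
      (mul_le_mul_of_nonneg_right ?_ (abs_nonneg _))
    exact hδ _ _ (hg.norm_eq j) (hg'.norm_eq j) ((hgg j).trans_le (min_le_left _ _)) j y
  refine (norm_le_norm_of_abs_le_abs h1).trans ((norm_sum_le _ _).trans ?_)
  have h2 : ∀ j ∈ Finset.univ, ‖M • |g j - g' j| + η • |g' j|‖ ≤ 2 * η := by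
    intro j _
    refine (norm_add_le _ _).trans ?_
    rw [norm_smul, norm_smul, norm_abs_eq_norm, norm_abs_eq_norm, hg'.norm_eq j, mul_one,
      Real.norm_of_nonneg hM0, Real.norm_of_nonneg hη0.le]
    have h3 := (hgg j).le.trans (min_le_right _ _)
    rw [le_div_iff₀ (by positivity)] at h3
    nlinarith [norm_nonneg (g j - g' j)]
  refine (Finset.sum_le_card_nsmul _ _ _ h2).trans ?_
  rw [nsmul_eq_mul, Finset.card_univ, ← hn, hη]
  have h4 : n * (2 * (ε / (2 * (n + 1)))) = ε * (n / (n + 1)) := by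
    field_simp
  rw [h4]
  exact mul_le_of_le_one_right hε.le ((div_le_one (by positivity)).mpr (by linarith))

/-- Approximation by continuous functions loses nothing uniformly in the tuple, because all these
maps are isometries. -/
theorem GoodTuple.iso_close (hq : q ≠ ∞)
    (h : Lp ℝ q ((Measure.count : Measure J).prod (volume : Measure I))) {ε : ℝ} (hε : 0 < ε) :
    ∃ δ > 0, ∀ (g g' : J → Lp ℝ q (volume : Measure I)) (hg : GoodTuple g) (hg' : GoodTuple g'),
      (∀ j, ‖g j - g' j‖ < δ) → ‖hg.iso hq h - hg'.iso hq h‖ < ε := by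
  obtain ⟨v, hv⟩ := (ContinuousMap.toLp_denseRange ℝ
    ((Measure.count : Measure J).prod (volume : Measure I)) ℝ hq).exists_dist_lt h
    (by positivity : 0 < ε / 4)
  obtain ⟨δ, hδ0, hδ⟩ := GoodTuple.iso_continuousMap_close hq v (by positivity : 0 < ε / 4)
  refine ⟨δ, hδ0, fun g g' hg hg' hgg => ?_⟩
  have h1 := hδ g g' hg hg' hgg
  set k := ContinuousMap.toLp q ((Measure.count : Measure J).prod (volume : Measure I)) ℝ v
  have h2 : ‖hg.iso hq h - hg.iso hq k‖ < ε / 4 := by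
    rw [← map_sub, LinearIsometryEquiv.norm_map, ← dist_eq_norm]
    exact hv
  have h3 : ‖hg'.iso hq k - hg'.iso hq h‖ < ε / 4 := by
    rw [← map_sub, LinearIsometryEquiv.norm_map, ← dist_eq_norm, dist_comm]
    exact hv
  have h4 : hg.iso hq h - hg'.iso hq h = (hg.iso hq h - hg.iso hq k) +
      (hg.iso hq k - hg'.iso hq k) + (hg'.iso hq k - hg'.iso hq h) := by abel
  rw [h4]
  refine (norm_add₃_le).trans_lt ?_
  linarith

/-- A continuous map on the space of good tuples composed with a measurable family of them. -/
theorem GoodTuple.stronglyMeasurable_iso (hq : q ≠ ∞) {Z : Type*} [MeasurableSpace Z]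
    {g : Z → J → Lp ℝ q (volume : Measure I)} (hgm : ∀ j, StronglyMeasurable fun z => g z j)
    (hg : ∀ z, GoodTuple (g z))
    (h : Lp ℝ q ((Measure.count : Measure J).prod (volume : Measure I))) :
    StronglyMeasurable fun z => (hg z).iso hq h := by
  have : Fact (q ≠ ∞) := ⟨hq⟩
  borelize ↥(Lp ℝ q (volume : Measure I))
  let Θ : {g : J → Lp ℝ q (volume : Measure I) // GoodTuple g} → Lp ℝ q (volume : Measure I) :=
    fun g => g.2.iso hq h
  have hΘ : Continuous Θ := by
    rw [Metric.continuous_iff]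
    intro g ε hε
    obtain ⟨δ, hδ0, hδ⟩ := GoodTuple.iso_close hq h hε
    refine ⟨δ, hδ0, fun g' hgg => ?_⟩
    rw [dist_eq_norm]
    refine hδ _ _ _ _ fun j => ?_
    rw [← dist_eq_norm]
    exact (dist_le_pi_dist _ _ j).trans_lt hgg
  have hmeas : Measurable fun z => (⟨g z, hg z⟩ :
      {g : J → Lp ℝ q (volume : Measure I) // GoodTuple g}) :=
    (measurable_pi_iff.mpr fun j => (hgm j).measurable).subtype_mk
  exact (hΘ.measurable.comp hmeas).stronglyMeasurable

end FibreTransport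

/-- Two measurable families of good tuples are intertwined by a measurable family of lattice
isometries. -/
theorem exists_fibre_transport {q : ℝ≥0∞} [Fact (1 ≤ q)] (hq : q ≠ ∞) {J : Type*} [Fintype J]
    {Z : Type*} [MeasurableSpace Z] {ρ : Measure Z} {g₁ g₂ : Z → J → Lp ℝ q (volume : Measure I)}
    (hm₁ : ∀ j, AEStronglyMeasurable (fun z => g₁ z j) ρ)
    (hm₂ : ∀ j, AEStronglyMeasurable (fun z => g₂ z j) ρ)
    (hg₁ : ∀ᵐ z ∂ρ, GoodTuple (g₁ z)) (hg₂ : ∀ᵐ z ∂ρ, GoodTuple (g₂ z)) :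
    ∃ W : Z → Lp ℝ q (volume : Measure I) ≃ₗᵢ[ℝ] Lp ℝ q (volume : Measure I),
      (∀ z, PreservesLattice (W z)) ∧ (∀ v, StronglyMeasurable fun z => W z v) ∧
      ∀ᵐ z ∂ρ, ∀ j, W z (g₁ z j) = g₂ z j := by
  classical
  have : Fact (q ≠ ∞) := ⟨hq⟩
  let _ : TopologicalSpace J := ⊥
  have : DiscreteTopology J := ⟨rfl⟩
  let _ : MeasurableSpace J := ⊤
  have hall : ∀ᵐ z ∂ρ, GoodTuple (g₁ z) ∧ GoodTuple (g₂ z) ∧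
      (∀ j, g₁ z j = (hm₁ j).mk _ z) ∧ ∀ j, g₂ z j = (hm₂ j).mk _ z := by
    filter_upwards [hg₁, hg₂, ae_all_iff.mpr fun j => (hm₁ j).ae_eq_mk,
      ae_all_iff.mpr fun j => (hm₂ j).ae_eq_mk] with z h1 h2 h3 h4
    exact ⟨h1, h2, h3, h4⟩
  obtain ⟨S, hSsub, hSm, hS0⟩ := exists_measurable_superset_of_null hall
  by_cases hne : ∃ z₀, z₀ ∉ S
  swap
  -- Here the null set `S` is the whole space, so any family will do.
  · refine ⟨fun _ => LinearIsometryEquiv.refl ℝ _, fun z => ⟨fun _ _ => rfl, fun _ _ => rfl⟩,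
      fun v => stronglyMeasurable_const, ?_⟩
    filter_upwards [measure_eq_zero_iff_ae_notMem.mp hS0] with z hz
    exact absurd ⟨z, hz⟩ hne
  obtain ⟨z₀, hz₀⟩ := hne
  have hgood : ∀ z, z ∉ S → GoodTuple (g₁ z) ∧ GoodTuple (g₂ z) ∧
      (∀ j, g₁ z j = (hm₁ j).mk _ z) ∧ ∀ j, g₂ z j = (hm₂ j).mk _ z := by
    intro z hz
    by_contra h
    exact hz (hSsub h)
  -- On the exceptional set the tuples are frozen at their value at `z₀`, so that they are good and
  -- strongly measurable everywhere.
  let k₁ : Z → J → Lp ℝ q (volume : Measure I) := fun z => if z ∈ S then g₁ z₀ else g₁ z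
  let k₂ : Z → J → Lp ℝ q (volume : Measure I) := fun z => if z ∈ S then g₂ z₀ else g₂ z
  have hk₁ : ∀ z, GoodTuple (k₁ z) := by
    intro z
    by_cases h : z ∈ S
    · simp only [k₁, if_pos h]; exact (hgood z₀ hz₀).1
    · simp only [k₁, if_neg h]; exact (hgood z h).1
  have hk₂ : ∀ z, GoodTuple (k₂ z) := by
    intro z
    by_cases h : z ∈ S
    · simp only [k₂, if_pos h]; exact (hgood z₀ hz₀).2.1
    · simp only [k₂, if_neg h]; exact (hgood z h).2.1
  have hkm₁ : ∀ j, StronglyMeasurable fun z => k₁ z j := by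
    intro j
    have : (fun z => k₁ z j) = S.piecewise (fun _ => g₁ z₀ j) ((hm₁ j).mk _) := by
      funext z
      by_cases h : z ∈ S
      · simp [k₁, h]
      · simp [k₁, h, (hgood z h).2.2.1 j]
    rw [this]
    exact StronglyMeasurable.piecewise hSm stronglyMeasurable_const (hm₁ j).stronglyMeasurable_mk
  have hkm₂ : ∀ j, StronglyMeasurable fun z => k₂ z j := by
    intro j
    have : (fun z => k₂ z j) = S.piecewise (fun _ => g₂ z₀ j) ((hm₂ j).mk _) := by
      funext z
      by_cases h : z ∈ S
      · simp [k₂, h]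
      · simp [k₂, h, (hgood z h).2.2.2 j]
    rw [this]
    exact StronglyMeasurable.piecewise hSm stronglyMeasurable_const (hm₂ j).stronglyMeasurable_mk
  refine ⟨fun z => ((hk₁ z).iso hq).symm.trans ((hk₂ z).iso hq), fun z => ?_, fun v => ?_, ?_⟩
  · exact PreservesLattice.comp (f := (hk₂ z).iso hq) (g := ((hk₁ z).iso hq).symm)
      ((hk₂ z).exists_iso hq).choose_spec.1 (PreservesLattice.symm ((hk₁ z).exists_iso hq).choose_spec.1)
  · exact StronglyMeasurable.operator_apply (W := fun z => (hk₂ z).iso hq)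
      (GoodTuple.stronglyMeasurable_iso hq hkm₂ hk₂)
      (stronglyMeasurable_symm_apply (GoodTuple.stronglyMeasurable_iso hq hkm₁ hk₁) v)
  · filter_upwards [measure_eq_zero_iff_ae_notMem.mp hS0] with z hz j
    have h1 : (hk₁ z).iso hq (copyIndicator q j) = k₁ z j :=
      ((hk₁ z).exists_iso hq).choose_spec.2.1 j
    have h2 : (hk₂ z).iso hq (copyIndicator q j) = k₂ z j :=
      ((hk₂ z).exists_iso hq).choose_spec.2.1 j
    have e1 : k₁ z j = g₁ z j := by simp only [k₁, if_neg hz]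
    have e2 : k₂ z j = g₂ z j := by simp only [k₂, if_neg hz]
    rw [LinearIsometryEquiv.trans_apply, ← e2, ← e1, ← h2, ← h1,
      LinearIsometryEquiv.symm_apply_apply]

/-! ### Full support passes to almost every fibre -/

section FullSupport

variable {p q : ℝ≥0∞} [Fact (1 ≤ p)] [Fact (1 ≤ q)]

/-- The indicator function of the zero set of an element of `L_q[0,1]`. -/
noncomputable def zeroIndicator (g : Lp ℝ q (volume : Measure I)) : Lp ℝ q (volume : Measure I) :=
  indicatorConstLp q (s := {y | g y = 0})
    (measurableSet_eq_fun (Lp.stronglyMeasurable g).measurable measurable_const)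
    (measure_ne_top _ _) 1

theorem zeroIndicator_ae (g : Lp ℝ q (volume : Measure I)) :
    ∀ᵐ y, (g y = 0 → zeroIndicator g y = 1) ∧ (g y ≠ 0 → zeroIndicator g y = 0) := by
  filter_upwards [indicatorConstLp_coeFn (p := q) (s := {y | g y = 0})
    (hs := measurableSet_eq_fun (Lp.stronglyMeasurable g).measurable measurable_const)
    (hμs := measure_ne_top (volume : Measure I) _) (c := (1 : ℝ))] with y hy
  constructor
  · intro h
    exact hy.trans (Set.indicator_of_mem (s := {y | g y = 0}) h _)
  · intro h
    exact hy.trans (Set.indicator_of_notMem (s := {y | g y = 0}) h _)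

/-- Dominated convergence. The approximants are built by continuous lattice operations, so the zero
indicator of a measurable family of fibres is again measurable. -/
theorem tendsto_zeroIndicator (hq : q ≠ ∞) {g : Lp ℝ q (volume : Measure I)} (hg : 0 ≤ g) :
    Filter.Tendsto (fun n : ℕ => Lp.const q (volume : Measure I) (1 : ℝ) -
      ((n : ℝ) • g ⊓ Lp.const q (volume : Measure I) (1 : ℝ))) Filter.atTop
      (nhds (zeroIndicator g)) := by
  have hq0 := toReal_pos_of_fact (p := q) hq
  rw [tendsto_iff_norm_sub_tendsto_zero]
  set d : ℕ → Lp ℝ q (volume : Measure I) := fun n => Lp.const q (volume : Measure I) (1 : ℝ) -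
      ((n : ℝ) • g ⊓ Lp.const q (volume : Measure I) (1 : ℝ)) - zeroIndicator g with hd
  have hdy : ∀ᵐ y, 0 ≤ g y ∧ ∀ n, d n y = if g y = 0 then 0 else 1 - min (n * g y) 1 := by
    have : ∀ᵐ y, ∀ n : ℕ, d n y = if g y = 0 then 0 else 1 - min (n * g y) 1 := by
      rw [ae_all_iff]
      intro n
      filter_upwards [Lp.coeFn_sub (Lp.const q (volume : Measure I) (1 : ℝ) -
          ((n : ℝ) • g ⊓ Lp.const q (volume : Measure I) (1 : ℝ))) (zeroIndicator g),
        Lp.coeFn_sub (Lp.const q (volume : Measure I) (1 : ℝ))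
          ((n : ℝ) • g ⊓ Lp.const q (volume : Measure I) (1 : ℝ)),
        Lp.coeFn_inf ((n : ℝ) • g) (Lp.const q (volume : Measure I) (1 : ℝ)),
        Lp.coeFn_smul (n : ℝ) g, Lp.coeFn_const (p := q) (μ := (volume : Measure I)) (1 : ℝ),
        zeroIndicator_ae g] with y h1 h2 h3 h4 h5 h6
      simp only [hd]
      rw [h1, Pi.sub_apply, h2, Pi.sub_apply, h3, Pi.inf_apply, h4, Pi.smul_apply, h5,
        smul_eq_mul, Function.const_apply]
      by_cases h : g y = 0
      · rw [if_pos h, h6.1 h, h]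
        simp
      · rw [if_neg h, h6.2 h, sub_zero]
    filter_upwards [this, (Lp.coeFn_nonneg g).mpr hg] with y h1 h2 using ⟨h2, h1⟩
  have h1 : Filter.Tendsto (fun n => ∫ y, ‖d n y‖ ^ q.toReal) Filter.atTop
      (nhds (∫ _y : I, (0 : ℝ))) := by
    refine tendsto_integral_of_dominated_convergence (fun _ => 1)
      (fun n => (Lp_integrable_norm_rpow hq (d n)).aestronglyMeasurable) (integrable_const _)
      (fun n => ?_) ?_
    · filter_upwards [hdy] with y ⟨h0, hy⟩
      rw [Real.norm_of_nonneg (by positivity), hy n]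
      refine Real.rpow_le_one (norm_nonneg _) ?_ hq0.le
      split_ifs with h
      · simp
      · have h3 : 0 ≤ min ((n : ℝ) * g y) 1 := le_min (by positivity) zero_le_one
        have h4 : min ((n : ℝ) * g y) 1 ≤ 1 := min_le_right _ _
        rw [Real.norm_of_nonneg (by linarith)]
        linarith
    · filter_upwards [hdy] with y ⟨h0, hy⟩
      refine tendsto_const_nhds.congr' ?_
      by_cases h : g y = 0
      · refine Filter.Eventually.of_forall fun n => ?_
        simp only
        rw [hy n, if_pos h, norm_zero, Real.zero_rpow hq0.ne']
      · obtain ⟨N, hN⟩ := exists_nat_ge (1 / g y)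
        have hpos : 0 < g y := lt_of_le_of_ne h0 (Ne.symm h)
        filter_upwards [Filter.eventually_ge_atTop N] with n hn
        have : 1 ≤ (n : ℝ) * g y := by
          rw [← div_le_iff₀ hpos]
          exact hN.trans (by exact_mod_cast hn)
        rw [hy n, if_neg h, min_eq_right this, sub_self, norm_zero, Real.zero_rpow hq0.ne']
  simp_rw [← Lp_norm_rpow_eq_integral hq, integral_zero] at h1
  have h2 := h1.rpow_const (p := q.toReal⁻¹) (Or.inr (by positivity))
  rw [Real.zero_rpow (by positivity)] at h2
  refine h2.congr fun n => ?_
  rw [← Real.rpow_mul (norm_nonneg _), mul_inv_cancel₀ hq0.ne', Real.rpow_one]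

/-- If a finite family of positive elements fully supports `L_p(L_q)`, then almost all fibres do. -/
theorem fibre_supp_of_fullySupports (hq : q ≠ ∞) {Z : Type*} [MeasurableSpace Z] {ρ : Measure Z}
    [IsFiniteMeasure ρ] {A : Type*} [Fintype A] {c : A → Lp (Lp ℝ q (volume : Measure I)) p ρ}
    (hc : ∀ a, 0 ≤ c a)
    (hs : ∀ x : Lp (Lp ℝ q (volume : Measure I)) p ρ, (∀ a, |x| ⊓ |c a| = 0) → x = 0) :
    ∀ᵐ z ∂ρ, ∀ᵐ y, ∃ a, c a z y ≠ 0 := by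
  classical
  set G : Lp (Lp ℝ q (volume : Measure I)) p ρ := ∑ a, c a with hG
  have hG0 : 0 ≤ G := Finset.sum_nonneg fun a _ => hc a
  have hcG : ∀ a, c a ≤ G := fun a =>
    Finset.single_le_sum (f := c) (fun b _ => hc b) (Finset.mem_univ a)
  have hGm := Lp.aestronglyMeasurable G
  have hm : AEStronglyMeasurable (fun z => zeroIndicator (G z)) ρ := by
    refine aestronglyMeasurable_of_tendsto_ae Filter.atTop (f := fun (n : ℕ) z =>
      Lp.const q (volume : Measure I) (1 : ℝ) -
      ((n : ℝ) • G z ⊓ Lp.const q (volume : Measure I) (1 : ℝ))) (fun n => ?_) ?_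
    · exact aestronglyMeasurable_const.sub
        ((hGm.const_smul (n : ℝ)).inf aestronglyMeasurable_const)
    · filter_upwards [(Lp.coeFn_nonneg G).mpr hG0] with z hz
      exact tendsto_zeroIndicator hq hz
  have hmem : MemLp (fun z => zeroIndicator (G z)) p ρ := by
    refine MemLp.of_bound hm ‖Lp.const q (volume : Measure I) (1 : ℝ)‖
      (Filter.Eventually.of_forall fun z => norm_le_norm_of_abs_le_abs ?_)
    rw [← Lp.coeFn_le]
    filter_upwards [Lp.coeFn_abs (zeroIndicator (G z)),
      Lp.coeFn_abs (Lp.const q (volume : Measure I) (1 : ℝ)),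
      Lp.coeFn_const (p := q) (μ := (volume : Measure I)) (1 : ℝ), zeroIndicator_ae (G z)]
      with y h1 h2 h3 h4
    rw [h1, h2, h3]
    by_cases h : G z y = 0
    · rw [h4.1 h, Function.const_apply]
    · rw [h4.2 h, Function.const_apply]
      simp
  -- The fibrewise indicator of the zero set of `G` is disjoint from every `c a`, since `0 ≤ c a ≤
  -- G`; full support makes it zero.
  have hzero := hs (hmem.toLp _) (fun a => by
    apply Lp.ext
    filter_upwards [Lp.coeFn_inf |hmem.toLp _| |c a|, Lp.coeFn_abs (hmem.toLp _),
      Lp.coeFn_abs (c a), hmem.coeFn_toLp, Lp.coeFn_zero (Lp ℝ q (volume : Measure I)) p ρ,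
      (Lp.coeFn_nonneg (c a)).mpr (hc a), (Lp.coeFn_le (c a) G).mpr (hcG a)]
      with z h1 h2 h3 h4 h5 h6 h7
    rw [h1, Pi.inf_apply, h2, h3, h4, h5, Pi.zero_apply]
    apply Lp.ext
    filter_upwards [Lp.coeFn_inf |zeroIndicator (G z)| |c a z|, Lp.coeFn_abs (zeroIndicator (G z)),
      Lp.coeFn_abs (c a z), Lp.coeFn_zero ℝ q (volume : Measure I), zeroIndicator_ae (G z),
      (Lp.coeFn_nonneg (c a z)).mpr h6, (Lp.coeFn_le (c a z) (G z)).mpr h7]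
      with y k1 k2 k3 k4 k5 k6 k7
    rw [k1, Pi.inf_apply, k2, k3, k4, Pi.zero_apply]
    by_cases h : G z y = 0
    · have : c a z y = 0 := le_antisymm (k7.trans h.le) k6
      rw [this, abs_zero]
      exact inf_eq_right.mpr (abs_nonneg _)
    · rw [k5.2 h, abs_zero]
      exact inf_eq_left.mpr (abs_nonneg _))
  have h1 := hmem.coeFn_toLp
  rw [hzero] at h1
  filter_upwards [h1, Lp.coeFn_zero (Lp ℝ q (volume : Measure I)) p ρ,
    Lp.coeFn_finsetSum (Finset.univ : Finset A) c] with z h1 h2 h3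
  rw [h2, Pi.zero_apply] at h1
  rw [Finset.sum_apply] at h3
  have h4 := Lp.coeFn_finsetSum (Finset.univ : Finset A) (fun a => c a z)
  filter_upwards [zeroIndicator_ae (G z), Lp.coeFn_zero ℝ q (volume : Measure I), h4]
    with y k1 k2 k3
  by_contra hcon
  push Not at hcon
  have h5 : G z y = 0 := by
    rw [hG, h3, k3, Finset.sum_apply]
    exact Finset.sum_eq_zero fun a _ => hcon a
  have := k1.1 h5
  rw [← h1, k2] at this
  exact zero_ne_one this

end FullSupport

theorem ae_of_ae_comp_measurePreserving {α β : Type*} [MeasurableSpace α] [MeasurableSpace β]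
    {μ : Measure α} {ν : Measure β} {F : α → β} (hF : MeasurePreserving F μ ν) {P : β → Prop}
    (hP : MeasurableSet {z | P z}) (h : ∀ᵐ x ∂μ, P (F x)) : ∀ᵐ z ∂ν, P z := by
  rw [← hF.map_eq, ae_map_iff hF.measurable.aemeasurable hP]
  exact h

/-! ### Normal form of an atom system and construction of the automorphism -/

section Normalization

variable {p q : ℝ≥0∞} [Fact (1 ≤ p)] [Fact (1 ≤ q)]

/-- A finite family of positive normalized disjoint elements of `L_p(L_q)` which fully supports it,
and whose fibre norms agree or are disjoint according to a partition of the index set. -/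
structure AtomSystem {Z : Type*} [MeasurableSpace Z] {ρ : Measure Z} {A K : Type*} (κ : A → K)
    (c : A → Lp (Lp ℝ q (volume : Measure I)) p ρ) : Prop where
  nonneg : ∀ a, 0 ≤ c a
  disjoint : Pairwise fun a b => c a ⊓ c b = 0
  norm_eq : ∀ a, ‖c a‖ = 1
  supp : ∀ x : Lp (Lp ℝ q (volume : Measure I)) p ρ, (∀ a, |x| ⊓ |c a| = 0) → x = 0
  fibre_norm_eq : ∀ a b, κ a = κ b → ∀ᵐ z ∂ρ, ‖c a z‖ = ‖c b z‖
  fibre_disjoint : ∀ a b, κ a ≠ κ b → ∀ᵐ z ∂ρ, c a z = 0 ∨ c b z = 0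

variable {A K : Type*} [Fintype A] [Fintype K] {κ : A → K}

/-- The common fibre norms of the classes form a good tuple in $L_p[0,1]$, so the transport applies
to the base. Their supports cover because a fibre in which all atoms vanish cannot be fully
supported. -/
theorem AtomSystem.exists_baseTuple (hq : q ≠ ∞) {c : A → LpLq p q}
    (hc : AtomSystem κ c) (hκ : Function.Surjective κ) :
    ∃ N : K → Lp ℝ p (volume : Measure I), GoodTuple N ∧
      ∀ a, ∀ᵐ x, N (κ a) x = ‖c a x‖ := by
  choose s hs using hκ
  have hN : ∀ k, ((Lp.memLp (c (s k))).norm.toLp _ : Lp ℝ p (volume : Measure I)) =ᵐ[volume]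
      fun x => ‖c (s k) x‖ := fun k => MemLp.coeFn_toLp _
  have hNa : ∀ a, ∀ᵐ x, ((Lp.memLp (c (s (κ a)))).norm.toLp _ : Lp ℝ p (volume : Measure I)) x =
      ‖c a x‖ := by
    intro a
    filter_upwards [hN (κ a), hc.fibre_norm_eq (s (κ a)) a (hs _)] with x h1 h2
    rw [h1, h2]
  refine ⟨fun k => (Lp.memLp (c (s k))).norm.toLp _, ⟨fun k => ?_, fun k l hkl => ?_, fun k => ?_,
    ?_⟩, hNa⟩
  · rw [← Lp.coeFn_nonneg]
    filter_upwards [hN k] with x h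
    rw [h]
    exact norm_nonneg _
  · apply Lp.ext
    filter_upwards [Lp.coeFn_inf ((Lp.memLp (c (s k))).norm.toLp _)
      ((Lp.memLp (c (s l))).norm.toLp _), hN k, hN l,
      Lp.coeFn_zero ℝ p (volume : Measure I),
      hc.fibre_disjoint (s k) (s l) (by rwa [hs, hs])] with x h1 h2 h3 h4 h5
    rw [h1, Pi.inf_apply, h2, h3, h4, Pi.zero_apply]
    rcases h5 with h5 | h5 <;> rw [h5, norm_zero]
    · exact inf_eq_left.mpr (norm_nonneg _)
    · exact inf_eq_right.mpr (norm_nonneg _)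
  · rw [← hc.norm_eq (s k), Lp.norm_toLp, Lp.norm_def, eLpNorm_norm]
  · filter_upwards [fibre_supp_of_fullySupports hq hc.nonneg hc.supp, ae_all_iff.mpr hNa]
      with x h1 h2
    have : ∃ a, c a x ≠ 0 := by
      by_contra hcon
      push Not at hcon
      have h3 : ∀ᵐ y : I, ∀ a, c a x y = 0 := by
        rw [ae_all_iff]
        intro a
        rw [hcon a]
        exact Lp.coeFn_zero ℝ q (volume : Measure I)
      obtain ⟨y, ⟨a, hy1⟩, hy2⟩ := (h1.and h3).exists
      exact hy1 (hy2 a)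
    obtain ⟨a, ha⟩ := this
    exact ⟨κ a, by rw [h2 a]; exact norm_ne_zero_iff.mpr ha⟩

/-- An atom system can be transported by a lattice isometry to one whose fibre norms are the
indicator functions of the copies of the unit interval indexed by the classes. -/
theorem AtomSystem.exists_normalization [MeasurableSpace K] [DiscreteMeasurableSpace K]
    (hp : p ≠ ∞) (hq : q ≠ ∞) {c : A → LpLq p q} (hc : AtomSystem κ c)
    (hκ : Function.Surjective κ) :
    ∃ B : Lp (Lp ℝ q (volume : Measure I)) p
        ((Measure.count : Measure K).prod (volume : Measure I)) ≃ₗᵢ[ℝ] LpLq p q,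
      PreservesLattice B ∧ ∀ a, ∀ᵐ z ∂((Measure.count : Measure K).prod (volume : Measure I)),
        (κ a = z.1 → ‖B.symm (c a) z‖ = 1) ∧ (κ a ≠ z.1 → ‖B.symm (c a) z‖ = 0) := by
  classical
  obtain ⟨N, hN, hNc⟩ := hc.exists_baseTuple hq hκ
  obtain ⟨F, T, G, hF, hT, hG, hG0, hpres, hTF, hNF, -⟩ := hN.exists_transport hp
  have hqmp : Measure.QuasiMeasurePreserving F volume (Measure.count.prod volume) :=
    ⟨hF, ((absolutelyContinuous_powMeasure hp hG hG0).map hF).trans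
      hpres.map_eq.absolutelyContinuous⟩
  obtain ⟨B, hB⟩ := exists_weightedComp (V := Lp ℝ q (volume : Measure I)) hp hT hG hG0 hpres hTF
  refine ⟨B, preservesLattice_of_ae_smul hG0 hqmp hB, fun a => ?_⟩
  have hms := (Lp.stronglyMeasurable (B.symm (c a))).norm.measurable
  have hmeas : MeasurableSet {z : K × I | (κ a = z.1 → ‖B.symm (c a) z‖ = 1) ∧
      (κ a ≠ z.1 → ‖B.symm (c a) z‖ = 0)} := by
    have h1 : MeasurableSet {z : K × I | κ a = z.1} :=
      measurable_fst (MeasurableSet.of_discrete (s := {k | κ a = k}))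
    exact (h1.imp (measurableSet_eq_fun hms measurable_const)).inter
      (h1.compl.imp (measurableSet_eq_fun hms measurable_const))
  have hac : powMeasure p (volume : Measure I) G ≪ volume := withDensity_absolutelyContinuous _ _
  refine ae_of_ae_comp_measurePreserving hpres hmeas (hac.ae_le ?_)
  -- At `x` the fibre norm of `c a` is `G x` times that of `B.symm (c a)` at `F x`. It also equals
  -- `N (κ a) x`, which is `G x` on the copy of class `κ a` and 0 elsewhere.
  filter_upwards [hB (B.symm (c a)), hG0, hNF, hNc a] with x h1 h2 h3 h4
  rw [B.apply_symm_apply] at h1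
  rw [h1, norm_smul, Real.norm_of_nonneg h2.le] at h4
  constructor
  · intro h
    rw [h, h3.1] at h4
    exact (mul_left_cancel₀ h2.ne' (by rw [mul_one]; exact h4)).symm
  · intro h
    rw [h3.2 _ h] at h4
    exact (mul_eq_zero.mp h4.symm).resolve_left h2.ne'

theorem PreservesLattice.map_abs {X Y : Type*} [NormedAddCommGroup X] [NormedSpace ℝ X] [Lattice X]
    [NormedAddCommGroup Y] [NormedSpace ℝ Y] [Lattice Y] {f : X ≃ₗᵢ[ℝ] Y}
    (hf : PreservesLattice f) (x : X) : f |x| = |f x| := by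
  change f (x ⊔ -x) = f x ⊔ -f x
  rw [hf.map_sup, map_neg]

/-- Over the copy with index `k` the atoms of other classes vanish, so those of class `k` alone must
cover the fibre, and they have norm one there. -/
theorem AtomSystem.ae_goodTuple [MeasurableSpace K] [DiscreteMeasurableSpace K] (hq : q ≠ ∞)
    {c : A → LpLq p q} (hc : AtomSystem κ c)
    {B : Lp (Lp ℝ q (volume : Measure I)) p
        ((Measure.count : Measure K).prod (volume : Measure I)) ≃ₗᵢ[ℝ] LpLq p q}
    (hB : PreservesLattice B)
    (hn : ∀ a, ∀ᵐ z ∂((Measure.count : Measure K).prod (volume : Measure I)),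
        (κ a = z.1 → ‖B.symm (c a) z‖ = 1) ∧ (κ a ≠ z.1 → ‖B.symm (c a) z‖ = 0)) (k : K) :
    ∀ᵐ s : I, GoodTuple fun j : {a // κ a = k} => B.symm (c j) (k, s) := by
  have hB' := hB.symm
  have h0 : ∀ a, 0 ≤ B.symm (c a) := fun a =>
    (PreservesLattice.nonneg_iff (f := B.symm.toLinearIsometry) hB').mpr (hc.nonneg a)
  have hd : ∀ a b, a ≠ b → B.symm (c a) ⊓ B.symm (c b) = 0 := fun a b hab => by
    rw [← hB'.map_inf, hc.disjoint hab, map_zero]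
  have hs := fibre_supp_of_fullySupports hq h0 (fun x hx => by
    apply B.injective
    rw [map_zero]
    refine hc.supp _ fun a => ?_
    rw [← hB.map_abs, ← B.apply_symm_apply (c a), ← hB.map_abs, ← hB.map_inf, hx a, map_zero])
  have hall : ∀ᵐ z ∂((Measure.count : Measure K).prod (volume : Measure I)),
      GoodTuple fun j : {a // κ a = z.1} => B.symm (c j) z := by
    have hd' : ∀ᵐ z ∂((Measure.count : Measure K).prod (volume : Measure I)), ∀ a b, a ≠ b →
        B.symm (c a) z ⊓ B.symm (c b) z = 0 := by
      rw [ae_all_iff]; intro a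
      rw [ae_all_iff]; intro b
      by_cases hab : a = b
      · simp [hab]
      · filter_upwards [fibre_inf_eq_zero (hd a b hab)] with z hz _ using hz
    filter_upwards [ae_all_iff.mpr fun a => (Lp.coeFn_nonneg _).mpr (h0 a), hd', hs,
      ae_all_iff.mpr hn] with z h1 h2 h3 h4
    refine ⟨fun j => h1 j, fun i j hij => h2 _ _ fun h => hij (Subtype.ext h),
      fun j => (h4 j).1 j.2, ?_⟩
    have h5 : ∀ᵐ y : I, ∀ a, κ a ≠ z.1 → B.symm (c a) z y = 0 := by
      rw [ae_all_iff]
      intro a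
      by_cases ha : κ a = z.1
      · simp [ha]
      · have := norm_eq_zero.mp ((h4 a).2 ha)
        filter_upwards [Lp.coeFn_zero ℝ q (volume : Measure I)] with y hy _
        rw [this]
        exact hy
    filter_upwards [h3, h5] with y ⟨a, ha⟩ h6
    by_cases hz : κ a = z.1
    · exact ⟨⟨a, hz⟩, ha⟩
    · exact absurd (h6 a hz) ha
  have h1 := Measure.ae_ae_of_ae_prod hall
  rw [Measure.ae_count_iff] at h1
  exact h1 k

/-- Two atom systems with the same partition of the index set are intertwined by a lattice
isometry. -/
theorem AtomSystem.exists_automorphism (hp : p ≠ ∞) (hq : q ≠ ∞) {c₁ c₂ : A → LpLq p q}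
    (hc₁ : AtomSystem κ c₁) (hc₂ : AtomSystem κ c₂) (hκ : Function.Surjective κ) :
    ∃ φ : LpLq p q ≃ₗᵢ[ℝ] LpLq p q, PreservesLattice φ ∧ ∀ a, φ (c₁ a) = c₂ a := by
  classical
  have : Fact (q ≠ ∞) := ⟨hq⟩
  let _ : MeasurableSpace K := ⊤
  obtain ⟨B₁, hB₁, hn₁⟩ := hc₁.exists_normalization hp hq hκ
  obtain ⟨B₂, hB₂, hn₂⟩ := hc₂.exists_normalization hp hq hκ
  have hm₁ : ∀ a, StronglyMeasurable (B₁.symm (c₁ a)) := fun a => Lp.stronglyMeasurable _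
  have hm₂ : ∀ a, StronglyMeasurable (B₂.symm (c₂ a)) := fun a => Lp.stronglyMeasurable _
  choose W hWl hWm hW using fun k => exists_fibre_transport hq
    (g₁ := fun (s : I) (j : {a // κ a = k}) => B₁.symm (c₁ j) (k, s))
    (g₂ := fun (s : I) (j : {a // κ a = k}) => B₂.symm (c₂ j) (k, s))
    (fun j => ((hm₁ j).comp_measurable measurable_prodMk_left).aestronglyMeasurable)
    (fun j => ((hm₂ j).comp_measurable measurable_prodMk_left).aestronglyMeasurable)
    (hc₁.ae_goodTuple hq hB₁ hn₁ k) (hc₂.ae_goodTuple hq hB₂ hn₂ k)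
  let W' : K × I → Lp ℝ q (volume : Measure I) ≃ₗᵢ[ℝ] Lp ℝ q (volume : Measure I) :=
    fun z => W z.1 z.2
  have hWm' : ∀ v, StronglyMeasurable fun z => W' z v := by
    intro v
    borelize ↥(Lp ℝ q (volume : Measure I))
    -- The index set of classes is finite, so measurability on each copy suffices.
    exact (measurable_from_prod_countable_right fun k => (hWm k v).measurable).stronglyMeasurable
  obtain ⟨T, hT⟩ := exists_fibrewise (p := p)
    (ρ := (Measure.count : Measure K).prod (volume : Measure I)) hWm'
  have hTc : ∀ a, T (B₁.symm (c₁ a)) = B₂.symm (c₂ a) := by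
    intro a
    apply Lp.ext
    have h1 : ∀ᵐ z ∂((Measure.count : Measure K).prod (volume : Measure I)),
        κ a = z.1 → W' z (B₁.symm (c₁ a) z) = B₂.symm (c₂ a) z := by
      have hmeas : MeasurableSet {z : K × I | κ a = z.1 →
          W' z (B₁.symm (c₁ a) z) = B₂.symm (c₂ a) z} := by
        have h1 : MeasurableSet {z : K × I | κ a = z.1} :=
          measurable_fst (MeasurableSet.of_discrete (s := {k | κ a = k}))
        exact h1.imp (StronglyMeasurable.measurableSet_eq_fun
          (StronglyMeasurable.operator_apply hWm' (hm₁ a)) (hm₂ a))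
      rw [Measure.ae_prod_iff_ae_ae hmeas, Measure.ae_count_iff]
      intro k
      filter_upwards [hW k] with s hs h
      exact hs ⟨a, h⟩
    filter_upwards [hT (B₁.symm (c₁ a)), h1, hn₁ a, hn₂ a] with z h1 h2 h3 h4
    rw [h1]
    by_cases h : κ a = z.1
    · exact h2 h
    · rw [norm_eq_zero.mp (h3.2 h), norm_eq_zero.mp (h4.2 h), map_zero]
  refine ⟨(B₁.symm.trans T).trans B₂, ?_, fun a => ?_⟩
  · exact PreservesLattice.comp (f := B₂) (g := fun x => T (B₁.symm x)) hB₂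
      (PreservesLattice.comp (f := T) (g := B₁.symm)
        (preservesLattice_of_fibrewise (fun z => hWl z.1 z.2) hT) hB₁.symm)
  · change B₂ (T (B₁.symm (c₁ a))) = c₂ a
    rw [hTc, B₂.apply_symm_apply]

end Normalization

/-! ### From embeddings to atom systems, and the theorem -/

/-- The images of the normalized atoms under a fully supporting isometric lattice embedding form an
atom system. -/
theorem atomSystem_of_embedding {p q : ℝ≥0∞} [Fact (1 ≤ p)] [Fact (1 ≤ q)] (hp : p ≠ ∞)
    (hq : q ≠ ∞) (hpq : p ≠ q) {E : Type*} [NormedAddCommGroup E] [NormedSpace ℝ E] [Lattice E]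
    {A K : Type*} {κ : A → K} {e : A → E} (he0 : ∀ a, 0 ≤ e a) (he1 : ∀ a, ‖e a‖ = 1)
    (hed : Pairwise fun a b => e a ⊓ e b = 0) (hspan : Submodule.span ℝ (Set.range e) = ⊤)
    (hsame : ∀ a b, a ≠ b → κ a = κ b → ‖e a + e b‖ ^ q.toReal = 2)
    (hdiff : ∀ a b, κ a ≠ κ b → ‖e a + e b‖ ^ p.toReal = 2) {f : E →ₗᵢ[ℝ] LpLq p q}
    (hf : PreservesLattice f) (hs : FullySupports (Set.range f)) :
    AtomSystem κ fun a => f (e a) := by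
  have h0 : ∀ a, 0 ≤ f (e a) := fun a => hf.nonneg_iff.mpr (he0 a)
  have hd : ∀ a b, a ≠ b → f (e a) ⊓ f (e b) = 0 := fun a b hab => by
    rw [← hf.map_inf, hed hab, map_zero]
  have h1 : ∀ a, ‖f (e a)‖ = 1 := fun a => by rw [f.norm_map, he1]
  refine ⟨h0, fun a b hab => hd a b hab, h1, fun x hx => ?_, fun a b hab => ?_, fun a b hab => ?_⟩
  · refine hs x ?_
    rintro _ ⟨y, rfl⟩
    -- Vectors whose image is disjoint from `x` form a subspace; containing the atoms, it is all of
    -- `E`.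
    have hle : Submodule.span ℝ (Set.range e) ≤
        (disjointComplement |x| (abs_nonneg x)).comap f.toLinearMap := by
      rw [Submodule.span_le]
      rintro _ ⟨a, rfl⟩
      change |f (e a)| ⊓ |x| = 0
      rw [inf_comm]
      exact hx a
    rw [hspan] at hle
    have : |f y| ⊓ |x| = 0 := hle (Submodule.mem_top (x := y))
    rw [LatticeDisjoint, inf_comm]
    exact this
  · by_cases h : a = b
    · subst h
      exact Filter.Eventually.of_forall fun _ => rfl
    · exact fibre_norm_eq_of_norm_add hp hq hpq (h0 a) (h0 b) (hd a b h) (h1 a) (h1 b)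
        (by rw [← map_add, f.norm_map]; exact hsame a b h hab)
  · have h : a ≠ b := fun h => hab (by rw [h])
    exact fibre_disjoint_of_norm_add hp hq hpq (h0 a) (h0 b) (hd a b h) (h1 a) (h1 b)
        (by rw [← map_add, f.norm_map]; exact hdiff a b hab)

theorem theoremt (p q : ℝ≥0∞) [Fact (1 ≤ p)] [Fact (1 ≤ q)] (hp : p ≠ ∞) (hq : q ≠ ∞)
    (hpq : p ≠ q)
    (E : Type u) [NormedAddCommGroup E] [NormedSpace ℝ E] [Lattice E] [HasSolidNorm E]
    [IsOrderedAddMonoid E] [IsOrderedModule ℝ E] [FiniteDimensional ℝ E]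
    (hE : IsBLpLq.{u, v, w} p q E)
    (f₁ f₂ : E →ₗᵢ[ℝ] LpLq p q) (hf₁ : PreservesLattice f₁) (hf₂ : PreservesLattice f₂)
    (hs₁ : FullySupports (Set.range f₁)) (hs₂ : FullySupports (Set.range f₂)) :
    ∃ φ : LpLq p q ≃ₗᵢ[ℝ] LpLq p q, PreservesLattice φ ∧ ∀ x : E, φ (f₁ x) = f₂ x := by
  classical
  obtain ⟨n, e, he0, he1, hed, heat, hspan⟩ := exists_atoms E
  have hdich : ∀ a b, a ≠ b → ‖e a + e b‖ ^ q.toReal = 2 ∨ ‖e a + e b‖ ^ p.toReal = 2 :=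
    fun a b hab => hE.norm_add_atoms hp hq (he0 a) (he0 b) (heat a) (heat b) (he1 a) (he1 b)
      (hed hab)
  have h0 : ∀ a, 0 ≤ f₁ (e a) := fun a => hf₁.nonneg_iff.mpr (he0 a)
  have hd : ∀ a b, a ≠ b → f₁ (e a) ⊓ f₁ (e b) = 0 := fun a b hab => by
    rw [← hf₁.map_inf, hed hab, map_zero]
  have h1 : ∀ a, ‖f₁ (e a)‖ = 1 := fun a => by rw [f₁.norm_map, he1]
  have hiff : ∀ a b, a ≠ b → (‖e a + e b‖ ^ q.toReal = 2 ↔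
      ∀ᵐ z, ‖f₁ (e a) z‖ = ‖f₁ (e b) z‖) := by
    intro a b hab
    refine ⟨fun h => fibre_norm_eq_of_norm_add hp hq hpq (h0 a) (h0 b) (hd a b hab) (h1 a) (h1 b)
        (by rw [← map_add, f₁.norm_map]; exact h), fun h => ?_⟩
    -- Fibres that are equal in norm and of which one always vanishes are both zero, against `‖f₁ (e
    -- a)‖ = 1`.
    refine (hdich a b hab).resolve_right fun h2 => ?_
    have h3 := fibre_disjoint_of_norm_add hp hq hpq (h0 a) (h0 b) (hd a b hab) (h1 a) (h1 b)
        (by rw [← map_add, f₁.norm_map]; exact h2)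
    have h4 : f₁ (e a) = 0 := by
      apply Lp.ext
      filter_upwards [h, h3, Lp.coeFn_zero (Lp ℝ q (volume : Measure I)) p (volume : Measure I)]
        with z h5 h6 h7
      rw [h7, Pi.zero_apply]
      rcases h6 with h6 | h6
      · exact h6
      · rwa [h6, norm_zero, norm_eq_zero] at h5
    have h5 := h1 a
    rw [h4, norm_zero] at h5
    exact zero_ne_one h5
  -- Equality of fibre norms under `f₁` makes transitivity evident. By `hiff` the relation on
  -- distinct atoms is expressed by norms in `E`, so the same classes serve `f₂`.
  let S : Setoid (Fin n) :=
    { r := fun a b => ∀ᵐ z, ‖f₁ (e a) z‖ = ‖f₁ (e b) z‖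
      iseqv :=
        { refl := fun _ => Filter.Eventually.of_forall fun _ => rfl
          symm := fun h => by filter_upwards [h] with z hz using hz.symm
          trans := fun h k => by filter_upwards [h, k] with z hz hk using hz.trans hk } }
  let κ : Fin n → Quotient S := Quotient.mk S
  have hsame : ∀ a b, a ≠ b → κ a = κ b → ‖e a + e b‖ ^ q.toReal = 2 := fun a b hab h =>
    (hiff a b hab).mpr (Quotient.exact h)
  have hdiff : ∀ a b, κ a ≠ κ b → ‖e a + e b‖ ^ p.toReal = 2 := by
    intro a b h
    have hab : a ≠ b := fun h' => h (by rw [h'])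
    exact (hdich a b hab).resolve_left fun h' => h (Quotient.sound ((hiff a b hab).mp h'))
  obtain ⟨φ, hφ, hφe⟩ := AtomSystem.exists_automorphism hp hq
    (atomSystem_of_embedding hp hq hpq he0 he1 hed hspan hsame hdiff hf₁ hs₁)
    (atomSystem_of_embedding hp hq hpq he0 he1 hed hspan hsame hdiff hf₂ hs₂)
    Quotient.mk_surjective
  refine ⟨φ, hφ, fun x => ?_⟩
  have hle : Submodule.span ℝ (Set.range e) ≤
      LinearMap.eqLocus (φ.toLinearEquiv.toLinearMap ∘ₗ f₁.toLinearMap) f₂.toLinearMap := by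
    rw [Submodule.span_le]
    rintro _ ⟨a, rfl⟩
    exact hφe a
  rw [hspan] at hle
  exact hle (Submodule.mem_top (x := x))
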